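/- Let $r\ge 1$ be an integer. Write $\mathscr H(r)$ for the real vector space of $r\times r$ complex Hermitian matrices, $dU=\prod_i dU_{ii}\prod_{i<j}d\,\mathrm{Re}\,U_{ij}\,d\,\mathrm{Im}\,U_{ij}$ for its Euclidean volume, and put $$B_r(a,b)=\int_{0<U<1_r}(\det U)^{a-r}\,(\det(1_r-U))^{b-r}\,dU ,$$ the integral being over $U\in\mathscr H(r)$ with $U$ and $1_r-U$ positive definite. Put $\mathbf b(s)=s(s+1)\cdots(s+r-1)$. Let $z=(z^{(1)},z^{(2)},z^{(3)})$ with $z^{(k)}\in\mathrm{Mat}_{2r,r}(\mathbb C)$ and $\det(z^{(i)},z^{(j)})\ne0$ for $i\neq j$, and let $$\mathbf x=\begin{pmatrix}1_r&0&1_r\\0&1_r&-1_r\end{pmatrix}.$$ For $z$ near $\mathbf x$ put $\binom{v_1}{v_2}=(z^{(1)},z^{(2)})^{-1}z^{(3)}$ and $g(z)=(z^{(1)},z^{(2)})\,\mathrm{diag}(1_r,-v_2v_1^{-1})$; then $z=g(z)\,\mathbf x\,h$ with $h=\mathrm{diag}(1_r,-v_1v_2^{-1},v_1)$ and $g(\mathbf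 x)=1_{2r}$. Let $C(z)$ be the cell $\{[(1_r,U)g(z)^{-1}] : U\in\mathscr H(r),\ 0<U<1_r\}$ in $\mathrm{Gr}(r,2r)$, parametrized by $U$, so that $C(\mathbf x)$ is $0<U<1_r$. For $\alpha=(\alpha^{(1)},\alpha^{(2)},\alpha^{(3)})\in\mathbb C^3$ with $\alpha^{(1)}+\alpha^{(2)}+\alpha^{(3)}=-2r$ and $\mathrm{Re}\,\alpha^{(2)},\mathrm{Re}\,\alpha^{(3)}>-1$ (call such $\alpha$ admissible), let $$F(z,\alpha)=\int_{C(z)}\prod_{k=1}^3\bigl(\det(\vec u z^{(k)})\bigr)^{\alpha^{(k)}}du,\qquad \vec u=(1_r,u),\quad du=\bigwedge_{k,l}du_{kl},$$ be the Radon hypergeometric function of type $(1,1,1)$ on $\mathrm{Gr}(2r,3r)$ for this cycle, written in the affine coordinate $u\in\mathrm{Mat}_r(\mathbb C)$ of $\mathrm{Gr}(r,2r)$, with principal branches of the powers. (The form $du$ is ordered so that on $\mathscr H(r)$ it restricts to $(-2\sqrt{-1})^{r(r-1)/2}\,dU$.) For $i\ne j$ let $\mathcal L^{(i,j)}=\det({}^tz^{(i)}\partial^{(j)})$,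 $\partial^{(j)}=(\partial/\partial z^{(j)}_{c,q})$, and let $\alpha+\epsilon^{(i)}-\epsilon^{(j)}$ denote $\alpha$ with $\alpha^{(i)}$ increased and $\alpha^{(j)}$ decreased by $1$. 1. There is an open neighbourhood $V$ of $\mathbf x$, contained in the set of $z$ as above and independent of $\alpha$, such that for $z\in V$ the cell $C(z)$ lies in the affine chart and the numbers $\det(\vec u z^{(k)})$ on it avoid $(-\infty,0]$, and such that for all admissible $\alpha$ the integral $F(z,\alpha)$ converges absolutely on $V$, is holomorphic in $z\in V$, and satisfies, for all $i\ne j$ such that $\alpha+\epsilon^{(i)}-\epsilon^{(j)}$ is admissible, the contiguity relation $$\mathcal L^{(i,j)}F(z,\alpha)=\mathbf b(\alpha^{(j)})\,F(z,\alpha+\epsilon^{(i)}-\epsilon^{(j)})\qquad(z\in V).$$ 2. For all admissible $\alpha$ and all $i\neq j$ the left side at the normal form is $$(\mathcal L^{(i,j)}F)(\mathbf x,\alpha)=\sigma_{ij}\,\mathbf b(\alpha^{(i)}+1)\,F(\mathbf x,\alpha),$$ with $\sigma_{ij}=(-1)^r$ if $1\in\{i,j\}$ and $\sigma_{ij}=1$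 otherwise. Hence the contiguity relation at $\mathbf x$ reads $\sigma_{ij}\mathbf b(\alpha^{(i)}+1)F(\mathbf x,\alpha)=\mathbf b(\alpha^{(j)})F(\mathbf x,\alpha+\epsilon^{(i)}-\epsilon^{(j)})$. 3. For $a,b\in\mathbb C$ with $\mathrm{Re}\,a>r-1$, $\mathrm{Re}\,b>r-1$, the integral $B_r(a,b)$ converges absolutely, and $$F(\mathbf x,(-a-b,\,a-r,\,b-r))=(-2\sqrt{-1})^{r(r-1)/2}\,B_r(a,b).$$ Thus the contiguity relations at $\mathbf x$ become relations for $B_r$, and one has, with nonzero denominators, $$B_r(a+1,b)=\frac{a(a-1)\cdots(a-r+1)}{(a+b)(a+b-1)\cdots(a+b-r+1)}\,B_r(a,b),$$ $$B_r(a,b+1)=\frac{b(b-1)\cdots(b-r+1)}{(a+b)(a+b-1)\cdots(a+b-r+1)}\,B_r(a,b).$$ -/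

import Mathlib

open scoped ComplexOrder

noncomputable section

namespace RadonBeta

/-! ### The Hermitian matrix integral beta function -/

/-- Real Euclidean coordinates on the space of `r × r` complex Hermitian matrices:
`x i i = U i i`, and `x i j = Re (U i j)`, `x j i = Im (U i j)` for `i < j`.
The Lebesgue measure `volume` on this space is the volume form
`dU = ∏ dU i i ∏_{i<j} dRe (U i j) dIm (U i j)`. -/
abbrev HermCoord (r : ℕ) : Type := Fin r → Fin r → ℝ

/-- The Hermitian matrix with given real coordinates. -/
def herm {r : ℕ} (x : HermCoord r) : Matrix (Fin r) (Fin r) ℂ :=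
  Matrix.of fun i j =>
    if i = j then (x i i : ℂ)
    else if i < j then (x i j : ℂ) + Complex.I * (x j i : ℂ)
    else (x j i : ℂ) - Complex.I * (x i j : ℂ)

/-- The domain `0 < U < 1_r` of Hermitian matrices, in real coordinates. -/
def betaDomain (r : ℕ) : Set (HermCoord r) :=
  {x | (herm x).PosDef ∧ (1 - herm x).PosDef}

/-- The integrand `(det U)^(a-r) (det (1_r - U))^(b-r)`. -/
def betaIntegrand (r : ℕ) (a b : ℂ) (x : HermCoord r) : ℂ :=
  (herm x).det ^ (a - r) * (1 - herm x).det ^ (b - r)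

/-- `B_r(a,b) = ∫_{0<U<1_r} (det U)^(a-r) (det (1_r - U))^(b-r) dU`. -/
def hermBeta (r : ℕ) (a b : ℂ) : ℂ :=
  ∫ x in betaDomain r, betaIntegrand r a b x

/-! ### Radon hypergeometric functions of type `(1,1,1)` on `Gr(2r,3r)` -/

/-- The entries of `z = (z⁽¹⁾, z⁽²⁾, z⁽³⁾)`, each `z⁽ᵏ⁾` being a `2r × r` matrix.
The blocks are numbered by `0, 1, 2`, and the `2r` row indices are split as `r + r`. -/
abbrev Vars (r : ℕ) : Type := Fin 3 → (Fin r ⊕ Fin r) → Fin r → ℂ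

/-- The block `z⁽ᵏ⁾` as a matrix. -/
def block {r : ℕ} (z : Vars r) (k : Fin 3) : Matrix (Fin r ⊕ Fin r) (Fin r) ℂ :=
  Matrix.of (z k)

/-- The space of those `z` for which every `2r × 2r` minor `det (z⁽ⁱ⁾, z⁽ʲ⁾)`, `i ≠ j`,
is nonzero. -/
def genericVars (r : ℕ) : Set (Vars r) :=
  {z | ∀ i j : Fin 3, i ≠ j → (Matrix.fromCols (block z i) (block z j)).det ≠ 0}

/-- The normal form
`((1,0,1),(0,1,-1))` (in `r × r` blocks). -/
def normalForm (r : ℕ) : Vars r :=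
  ![Matrix.fromRows (1 : Matrix (Fin r) (Fin r) ℂ) 0,
    Matrix.fromRows (0 : Matrix (Fin r) (Fin r) ℂ) 1,
    Matrix.fromRows (1 : Matrix (Fin r) (Fin r) ℂ) (-1)]

/-- The character `χ(h;α) = ∏ₖ (det h⁽ᵏ⁾)^(αₖ)` of (the universal cover of) `GL(r)³`, on the
principal branch. -/
def character {r : ℕ} (h : Fin 3 → Matrix (Fin r) (Fin r) ℂ) (α : Fin 3 → ℂ) : ℂ :=
  ∏ k, (h k).det ^ (α k)

/-- `u⃗ z = (u⃗ z⁽¹⁾, u⃗ z⁽²⁾, u⃗ z⁽³⁾)` with `u⃗ = (1_r, u)`, where `u` is the affine coordinate on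
the chart of `Gr(r,2r)`. -/
def incidence {r : ℕ} (u : Matrix (Fin r) (Fin r) ℂ) (z : Vars r) (k : Fin 3) :
    Matrix (Fin r) (Fin r) ℂ :=
  Matrix.fromCols (1 : Matrix (Fin r) (Fin r) ℂ) u * block z k

/-- The coefficient of the pullback of `du = ⋀ du_{k,l}` along `γ`: the determinant of the
`r² × r²` matrix of the partial derivatives `∂ u_{k,l} / ∂ x_{i,j}`. -/
def pullbackCoeff {r : ℕ} (γ : HermCoord r → Matrix (Fin r) (Fin r) ℂ) (x : HermCoord r) : ℂ :=
  Matrix.det (Matrix.of fun kl ij : Fin r × Fin r =>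
    lineDeriv ℝ (fun y => γ y kl.1 kl.2) x (Pi.single ij.1 (Pi.single ij.2 1)))

/-- The pullback of the integrand `χ(u⃗ z;α) du` along an `r²`-dimensional cell `u = γ x`. -/
def radonIntegrand {r : ℕ} (γ : HermCoord r → Matrix (Fin r) (Fin r) ℂ) (z : Vars r)
    (α : Fin 3 → ℂ) (x : HermCoord r) : ℂ :=
  character (incidence (γ x) z) α * pullbackCoeff γ x

/-- The integral `∫_C χ(u⃗ z;α) du` over the cell `C` parametrized by `γ` on `D`. -/
def radonIntegral {r : ℕ} (D : Set (HermCoord r)) (γ : HermCoord r → Matrix (Fin r) (Fin r) ℂ)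
    (z : Vars r) (α : Fin 3 → ℂ) : ℂ :=
  ∫ x in D, radonIntegrand γ z α x

/-! ### The family of cells that continues `0 < U < 1_r` -/

/-- `v = (z⁽¹⁾, z⁽²⁾)⁻¹ z⁽³⁾`, with upper and lower halves `v₁ = v.toRows₁`, `v₂ = v.toRows₂`. -/
def vMatrix {r : ℕ} (z : Vars r) : Matrix (Fin r ⊕ Fin r) (Fin r) ℂ :=
  (Matrix.fromCols (block z 0) (block z 1))⁻¹ * block z 2

/-- `g(z) = (z⁽¹⁾, z⁽²⁾) diag(1_r, -v₂ v₁⁻¹)`, the element of `GL(2r)` such that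
`z = g(z) 𝐱 h` with `𝐱` the normal form and `h = diag(1_r, -v₁ v₂⁻¹, v₁)`. -/
def gMatrix {r : ℕ} (z : Vars r) : Matrix (Fin r ⊕ Fin r) (Fin r ⊕ Fin r) ℂ :=
  Matrix.fromCols (block z 0) (block z 1) *
    Matrix.fromBlocks 1 0 0 (-((vMatrix z).toRows₂ * ((vMatrix z).toRows₁)⁻¹))

/-- Homogeneous coordinates `t = (1_r, U) g(z)⁻¹` of the points of the cell `C(z)`. -/
def cellHom {r : ℕ} (z : Vars r) (x : HermCoord r) : Matrix (Fin r) (Fin r ⊕ Fin r) ℂ :=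
  Matrix.fromCols (1 : Matrix (Fin r) (Fin r) ℂ) (herm x) * (gMatrix z)⁻¹

/-- The affine coordinate `u = (t')⁻¹ t''` of the points of `C(z)`, where `t = (t', t'')`.
At the normal form `g = 1_{2r}`, so that `C(𝐱)` is `0 < U < 1_r` itself. For `z` near `𝐱` the
element `g(z)` carries the complement of the hypersurfaces `det (t 𝐱⁽ᵏ⁾) = 0` to that of the
hypersurfaces `det (t z⁽ᵏ⁾) = 0`, and `C(z)` is the locally constant continuation of `C(𝐱)`. -/
def cell {r : ℕ} (z : Vars r) (x : HermCoord r) : Matrix (Fin r) (Fin r) ℂ :=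
  ((cellHom z x).toCols₁)⁻¹ * (cellHom z x).toCols₂

/-- The Radon hypergeometric function `F(z,α;C)` of type `(1,1,1)`, near the normal form, for the
cycle `C(z)` that continues `0 < U < 1_r`. -/
def radonBeta {r : ℕ} (z : Vars r) (α : Fin 3 → ℂ) : ℂ :=
  radonIntegral (betaDomain r) (cell z) z α

/-- The parameters for which `F(z,α;C)` is given by a convergent integral:
`α⁽¹⁾ + α⁽²⁾ + α⁽³⁾ = -2r` and `Re α⁽²⁾, Re α⁽³⁾ > -1`. -/
def Admissible (r : ℕ) (α : Fin 3 → ℂ) : Prop :=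
  ∑ k, α k = -(2 * r : ℂ) ∧ -1 < (α 1).re ∧ -1 < (α 2).re

/-- The parameters `(-a-b, a-r, b-r)`. -/
def betaParam (r : ℕ) (a b : ℂ) : Fin 3 → ℂ := ![-a - b, a - r, b - r]

/-- `α + ε⁽ⁱ⁾ - ε⁽ʲ⁾`. -/
def shift (α : Fin 3 → ℂ) (i j : Fin 3) : Fin 3 → ℂ :=
  α + Pi.single i 1 - Pi.single j 1

/-! ### The contiguity operators -/

/-- The partial derivative `∂ f / ∂ z⁽ʲ⁾_{c,q}`. -/
def partialZ {r : ℕ} (j : Fin 3) (c : Fin r ⊕ Fin r) (q : Fin r) (f : Vars r → ℂ) : Vars r → ℂ :=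
  fun z => lineDeriv ℂ f z (Pi.single j (Pi.single c (Pi.single q 1)))

/-- The `(p,q)` entry `∑_c z⁽ⁱ⁾_{c,p} ∂ / ∂ z⁽ʲ⁾_{c,q}` of the matrix `ᵗz⁽ⁱ⁾ ∂⁽ʲ⁾` of first order
operators. -/
def contigEntry {r : ℕ} (i j : Fin 3) (p q : Fin r) (f : Vars r → ℂ) : Vars r → ℂ :=
  fun z => ∑ c, z i c p * partialZ j c q f z

/-- The operator `det (ᵗz⁽ⁱ⁾ ∂⁽ʲ⁾)` of order `r`, as a column determinant
`∑_σ sgn σ L_{σ(1),1} L_{σ(2),2} ⋯ L_{σ(r),r}`. -/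
def contigOp {r : ℕ} (i j : Fin 3) (f : Vars r → ℂ) : Vars r → ℂ :=
  fun z => ∑ σ : Equiv.Perm (Fin r), ((Equiv.Perm.sign σ : ℤ) : ℂ) *
    (List.finRange r).foldr (fun q h => contigEntry i j (σ q) q h) f z

/-- The `b`-function `s (s+1) ⋯ (s+r-1)`. -/
def bFun (r : ℕ) (s : ℂ) : ℂ := ∏ k ∈ Finset.range r, (s + k)

/-- `s (s-1) ⋯ (s-r+1)`. -/
def fallFun (r : ℕ) (s : ℂ) : ℂ := ∏ k ∈ Finset.range r, (s - k)

end RadonBeta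

end

open RadonBeta

/-! On the cell `C(z)` the substitution z = g 𝐱 h trivializes the integral. With t = (1, U) g⁻¹ =
(t', t''), each det(u⃗ z⁽ᵏ⁾) is the positive number det((1, U) 𝐱⁽ᵏ⁾) times det(h⁽ᵏ⁾)/det t', and du
is (det t')^(-2r) (det g)^(-r) (-2i)^(r(r-1)/2) dU. Since the α⁽ᵏ⁾ add up to -2r, all powers of det
t' cancel. What depends on z leaves the integral as a product of powers of normalized minors, so
`radonBeta_eq` reads F(z,α) = `minorPower α z` · (-2i)^(r(r-1)/2) · B_r(α⁽²⁾+r, α⁽³⁾+r). Convergence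
and analyticity follow, and the contiguity relations split into two independent questions.

The first is the action of det(ᵗz⁽ⁱ⁾ ∂⁽ʲ⁾) on the minors. Its entries are derivations that move one
column of z⁽ʲ⁾ along a column of z⁽ⁱ⁾. They kill the minors (i,j) and (i,k). On the power of the
minor (j,k), and on the upper half Y of (z⁽ʲ⁾, z⁽ᵏ⁾)⁻¹ z⁽ⁱ⁾, they act as ∂/∂A_{pq} acts on (det A)^s
and A⁻¹. The Cayley identity (`CayleyPair.contigOp_eq`) then gives the factor b(s) det Y with s = -r
- α⁽ⁱ⁾. Here det Y is a quotient of minors, which is the change of `minorPower` under the shift of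
α, and b(s) = (-1)^r b(α⁽ⁱ⁾+1).

The second is the behaviour of B_r under shifts. Splitting off the first row and column by a Schur
complement turns each slice into a Dirichlet integral on ℝ × ℂⁿ. This gives B_{n+1}(a,b) = πⁿ
Γ(a-n)Γ(b-n)/Γ(a+b-n) · B_n(a,b), hence a closed product (`hermBeta_eq_prod`), from which the shift
relations follow by Γ(s+1) = sΓ(s). `hermBeta_contiguity` matches the constants for all six pairs
(i,j). -/

noncomputable section

namespace RadonBeta

open MeasureTheory

/-! ### Truncated powers and an elementary Dirichlet integral -/

/-- The truncated power `x₊^(q-1)`. -/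
def truncPow (x : ℝ) (q : ℂ) : ℂ := if 0 < x then (x : ℂ) ^ (q - 1) else 0

theorem truncPow_of_pos {x : ℝ} (hx : 0 < x) (q : ℂ) : truncPow x q = (x : ℂ) ^ (q - 1) :=
  if_pos hx

theorem truncPow_of_nonpos {x : ℝ} (hx : x ≤ 0) (q : ℂ) : truncPow x q = 0 :=
  if_neg hx.not_gt

theorem measurable_truncPow (q : ℂ) : Measurable fun x : ℝ => truncPow x q :=
  Measurable.ite measurableSet_Ioi (by fun_prop) measurable_const

/-- Lets the integrals of norms needed for Fubini be evaluated by the same formulas, with `q.re` in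
place of `q`. -/
theorem ofReal_norm_truncPow (x : ℝ) (q : ℂ) : ((‖truncPow x q‖ : ℝ) : ℂ) = truncPow x q.re := by
  rcases lt_or_ge 0 x with hx | hx
  · rw [truncPow_of_pos hx, truncPow_of_pos hx, Complex.norm_cpow_eq_rpow_re_of_pos hx,
      Complex.ofReal_cpow hx.le]
    simp
  · simp [truncPow_of_nonpos hx]

theorem truncPow_sub_eq_indicator (ρ : ℝ) (q : ℂ) :
    (fun t : ℝ => truncPow (ρ - t) q) =
      Set.indicator (Set.Iio ρ) fun t : ℝ => ((ρ - t : ℝ) : ℂ) ^ (q - 1) := by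
  funext t
  simp [truncPow, Set.indicator]

theorem intervalIntegrable_sub_cpow (ρ : ℝ) {q : ℂ} (hq : 0 < q.re) :
    IntervalIntegrable (fun t : ℝ => ((ρ - t : ℝ) : ℂ) ^ (q - 1)) volume 0 ρ := by
  have := (intervalIntegral.intervalIntegrable_cpow' (a := ρ) (b := 0) (r := q - 1)
    (by simpa using hq)).comp_sub_left ρ
  simpa using this

theorem integrableOn_truncPow_sub (ρ : ℝ) {q : ℂ} (hq : 0 < q.re) :
    IntegrableOn (fun t : ℝ => truncPow (ρ - t) q) (Set.Ioi 0) := by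
  rw [truncPow_sub_eq_indicator, integrableOn_indicator_iff measurableSet_Iio, Set.inter_comm,
    Set.Ioi_inter_Iio]
  rcases le_or_gt ρ 0 with h | h
  · simp [Set.Ioo_eq_empty h.not_gt]
  · exact ((intervalIntegrable_iff_integrableOn_Ioo_of_le h.le).1 (intervalIntegrable_sub_cpow ρ hq))

theorem integral_truncPow_sub (ρ : ℝ) {q : ℂ} (hq : 0 < q.re) :
    ∫ t in Set.Ioi (0 : ℝ), truncPow (ρ - t) q = q⁻¹ * truncPow ρ (q + 1) := by
  have hq0 : q ≠ 0 := by rintro rfl; simp at hq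
  rw [truncPow_sub_eq_indicator, setIntegral_indicator measurableSet_Iio, Set.Ioi_inter_Iio]
  rcases le_or_gt ρ 0 with h | h
  · simp [Set.Ioo_eq_empty h.not_gt, truncPow_of_nonpos h]
  · rw [← integral_Ioc_eq_integral_Ioo, ← intervalIntegral.integral_of_le h.le,
      intervalIntegral.integral_comp_sub_left (fun t : ℝ => (t : ℂ) ^ (q - 1)) ρ,
      integral_cpow (Or.inl (by simpa using hq)), truncPow_of_pos h]
    simp [hq0]
    ring

/-- Polar coordinates in ℂ followed by t = ‖w‖² reduce this to `integral_truncPow_sub`. -/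
theorem truncPow_disc (ρ : ℝ) {q : ℂ} (hq : 0 < q.re) :
    Integrable (fun w : ℂ => truncPow (ρ - ‖w‖ ^ 2) q) ∧
      ∫ w : ℂ, truncPow (ρ - ‖w‖ ^ 2) q = Real.pi / q * truncPow ρ (q + 1) := by
  have key := integrableOn_truncPow_sub ρ hq
  -- The Jacobian 2x of t = x² is twice the radial weight of the plane.
  have e : ∀ x ∈ Set.Ioi (0 : ℝ), (|(2 : ℝ)| * x ^ ((2 : ℝ) - 1)) • truncPow (ρ - x ^ (2 : ℝ)) q =
      (2 : ℝ) • (x ^ (Module.finrank ℝ ℂ - 1) • truncPow (ρ - x ^ 2) q) := by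
    intro x _
    rw [Complex.finrank_real_complex, smul_smul]
    norm_num
  constructor
  · rw [integrable_fun_norm_addHaar volume (f := fun y => truncPow (ρ - y ^ 2) q)]
    rw [← integrableOn_Ioi_comp_rpow_iff _ (two_ne_zero' ℝ), integrableOn_congr_fun e
      measurableSet_Ioi] at key
    have := Integrable.smul (2⁻¹ : ℝ) key
    refine this.congr (Filter.Eventually.of_forall fun x => ?_)
    simp
  · rw [integral_fun_norm_addHaar volume (f := fun y => truncPow (ρ - y ^ 2) q)]
    have h2 := integral_truncPow_sub ρ hq
    rw [← integral_comp_rpow_Ioi _ (two_ne_zero' ℝ), setIntegral_congr_fun measurableSet_Ioi e,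
      integral_smul] at h2
    have hv : volume.real (Metric.ball (0 : ℂ) 1) = Real.pi := by
      simp [Measure.real, Complex.volume_ball]
    rw [hv, Complex.finrank_real_complex] at *
    set I := ∫ y in Set.Ioi (0 : ℝ), y ^ (2 - 1) • truncPow (ρ - y ^ 2) q
    simp only [Complex.real_smul, nsmul_eq_mul] at h2 ⊢
    push_cast at h2 ⊢
    linear_combination (Real.pi : ℂ) * h2

theorem truncPow_beta {p q : ℂ} (hp : 0 < p.re) (hq : 0 < q.re) :
    Integrable (fun s : ℝ => truncPow s p * truncPow (1 - s) q) ∧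
      ∫ s : ℝ, truncPow s p * truncPow (1 - s) q = p.betaIntegral q := by
  have e : (fun s : ℝ => truncPow s p * truncPow (1 - s) q) =
      Set.indicator (Set.Ioo 0 1) fun s : ℝ => (s : ℂ) ^ (p - 1) * (1 - (s : ℂ)) ^ (q - 1) := by
    funext s
    by_cases h0 : 0 < s <;> by_cases h1 : s < 1 <;> simp [truncPow, Set.indicator, h0, h1]
  constructor
  · rw [e, integrable_indicator_iff measurableSet_Ioo]
    exact (intervalIntegrable_iff_integrableOn_Ioo_of_le zero_le_one).1
      (Complex.betaIntegral_convergent hp hq)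
  · rw [e, integral_indicator measurableSet_Ioo, Complex.betaIntegral,
      intervalIntegral.integral_of_le zero_le_one, integral_Ioc_eq_integral_Ioo]

/-- The integrand `s^(p-1) (1 - s - |η|²)^(q-1)` of Dirichlet type on `ℝ × ℂⁿ`. -/
def dirichletKernel (n : ℕ) (p q : ℂ) (w : ℝ × (Fin n → ℂ)) : ℂ :=
  truncPow w.1 p * truncPow (1 - w.1 - ∑ i, ‖w.2 i‖ ^ 2) q

theorem measurable_dirichletKernel (n : ℕ) (p q : ℂ) : Measurable (dirichletKernel n p q) :=
  ((measurable_truncPow p).comp measurable_fst).mul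
    ((measurable_truncPow q).comp (by fun_prop))

/-- The value of the integral of `dirichletKernel`. -/
def dirichletConst (n : ℕ) (p q : ℂ) : ℂ :=
  Real.pi ^ n * (Complex.Gamma p * Complex.Gamma q / Complex.Gamma (p + q + n))

/-- The equivalence `(s, η) ↦ ((s, (η₁, …, ηₙ)), η₀)`. -/
def splitFirst (n : ℕ) : ℝ × (Fin (n + 1) → ℂ) ≃ᵐ (ℝ × (Fin n → ℂ)) × ℂ :=
  ((MeasurableEquiv.refl ℝ).prodCongr
    ((MeasurableEquiv.piFinSuccAbove (fun _ => ℂ) 0).trans MeasurableEquiv.prodComm)).trans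
    MeasurableEquiv.prodAssoc.symm

theorem measurePreserving_splitFirst (n : ℕ) :
    MeasurePreserving (splitFirst n) volume volume := by
  have h1 : MeasurePreserving (MeasurableEquiv.prodComm : ℂ × (Fin n → ℂ) ≃ᵐ (Fin n → ℂ) × ℂ)
      volume volume := Measure.measurePreserving_swap
  have h2 := (volume_preserving_piFinSuccAbove (fun _ : Fin (n + 1) => ℂ) 0)
  exact (volume_preserving_prodAssoc).symm.comp
    ((MeasurePreserving.id volume).prod (h1.comp h2))

theorem splitFirst_apply (n : ℕ) (w : ℝ × (Fin (n + 1) → ℂ)) :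
    splitFirst n w = ((w.1, fun i => w.2 i.succ), w.2 0) := rfl

theorem dirichletKernel_succ (n : ℕ) (p q : ℂ) :
    dirichletKernel (n + 1) p q = (fun v : (ℝ × (Fin n → ℂ)) × ℂ => truncPow v.1.1 p *
      truncPow ((1 - v.1.1 - ∑ i, ‖v.1.2 i‖ ^ 2) - ‖v.2‖ ^ 2) q) ∘ splitFirst n := by
  funext w
  rw [dirichletKernel, Fin.sum_univ_succ, Function.comp_apply, splitFirst_apply]
  congr 2
  ring

theorem integral_norm_truncPow_disc (ρ : ℝ) {q : ℂ} (hq : 0 < q.re) :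
    ∫ w : ℂ, ‖truncPow (ρ - ‖w‖ ^ 2) q‖ = Real.pi / q.re * ‖truncPow ρ (q + 1)‖ := by
  have h := (truncPow_disc ρ (q := (q.re : ℂ)) (by simpa using hq)).2
  simp_rw [← ofReal_norm_truncPow] at h
  rw [integral_complex_ofReal, show (q.re : ℂ) + 1 = ((q + 1).re : ℂ) by simp,
    ← ofReal_norm_truncPow] at h
  exact_mod_cast h

theorem dirichletConst_succ (n : ℕ) (p : ℂ) {q : ℂ} (hq : 0 < q.re) :
    Real.pi / q * dirichletConst n p (q + 1) = dirichletConst (n + 1) p q := by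
  have hq0 : q ≠ 0 := by rintro rfl; simp at hq
  rw [dirichletConst, dirichletConst, Complex.Gamma_add_one q hq0,
    show p + (q + 1) + n = p + q + (n + 1 : ℕ) by push_cast; ring]
  field_simp
  ring

/-- Integrating out one complex coordinate raises `q` by one and costs π/q. The induction therefore
uses its hypothesis at `q + 1`, and `q` has to be generalized. -/
theorem dirichletKernel_integral (n : ℕ) {p q : ℂ} (hp : 0 < p.re) (hq : 0 < q.re) :
    Integrable (dirichletKernel n p q) ∧
      ∫ w, dirichletKernel n p q w = dirichletConst n p q := by
  induction n generalizing q with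
  | zero =>
    -- The space ℂ⁰ is a point, so the volume is Lebesgue measure on the line.
    have hv : (volume : Measure (ℝ × (Fin 0 → ℂ))) = volume.map fun s : ℝ => (s, 0) := by
      rw [Measure.volume_eq_prod, Measure.volume_pi_eq_dirac 0, Measure.prod_dirac]
    have hf : dirichletKernel 0 p q ∘ (fun s : ℝ => (s, (0 : Fin 0 → ℂ))) =
        fun s => truncPow s p * truncPow (1 - s) q := by
      funext s; simp [dirichletKernel]
    have hm := (measurable_dirichletKernel 0 p q).aestronglyMeasurable
      (μ := volume.map fun s : ℝ => (s, (0 : Fin 0 → ℂ)))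
    obtain ⟨h1, h2⟩ := truncPow_beta hp hq
    constructor
    · rw [hv, integrable_map_measure hm (by fun_prop), hf]
      exact h1
    · rw [hv, integral_map (by fun_prop) hm]
      have := congrArg (fun g => ∫ s, g s) hf
      simp only [Function.comp_apply] at this
      have hG : Complex.Gamma (p + q) ≠ 0 :=
        Complex.Gamma_ne_zero_of_re_pos (by simpa using add_pos hp hq)
      rw [this, h2, dirichletConst, Complex.Gamma_mul_Gamma_eq_betaIntegral hp hq]
      simp [hG]
  | succ n ih =>
    obtain ⟨i1, i2⟩ := ih (q := q + 1) (by simpa using hq.trans (lt_add_one _))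
    set G := fun v : (ℝ × (Fin n → ℂ)) × ℂ => truncPow v.1.1 p *
      truncPow ((1 - v.1.1 - ∑ i, ‖v.1.2 i‖ ^ 2) - ‖v.2‖ ^ 2) q with hG
    have hGm : Measurable G :=
      ((measurable_truncPow p).comp (by fun_prop)).mul ((measurable_truncPow q).comp (by fun_prop))
    have hGi : Integrable G := by
      rw [Measure.volume_eq_prod, integrable_prod_iff hGm.aestronglyMeasurable]
      refine ⟨Filter.Eventually.of_forall fun v =>
        (truncPow_disc (1 - v.1 - ∑ i, ‖v.2 i‖ ^ 2) hq).1.const_mul (truncPow v.1 p), ?_⟩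
      -- The integral of the norm over the last coordinate is again the norm of a kernel, in one
      -- variable fewer and with `q + 1`.
      refine (i1.norm.const_mul (Real.pi / q.re)).congr (Filter.Eventually.of_forall fun v => ?_)
      simp only [hG, norm_mul, integral_const_mul, integral_norm_truncPow_disc _ hq,
        dirichletKernel]
      ring
    rw [dirichletKernel_succ, (measurePreserving_splitFirst n).integrable_comp_emb
      (splitFirst n).measurableEmbedding]
    refine ⟨hGi, ?_⟩
    simp only [Function.comp_apply]
    rw [(measurePreserving_splitFirst n).integral_comp (splitFirst n).measurableEmbedding G,
      Measure.volume_eq_prod, integral_prod _ hGi, ← dirichletConst_succ n p hq, ← i2,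
      ← integral_const_mul]
    refine integral_congr_ae (Filter.Eventually.of_forall fun v => ?_)
    simp only [hG, integral_const_mul, (truncPow_disc _ hq).2, dirichletKernel]
    ring

/-! ### Peeling off the first row and column of a Hermitian matrix -/

/-- The coordinates of the lower right `n × n` block. -/
def hermTail {n : ℕ} (x : HermCoord (n + 1)) : HermCoord n := fun i j => x i.succ j.succ

/-- The first row of `herm x`, without the diagonal entry. -/
def hermRow {n : ℕ} (x : HermCoord (n + 1)) : Fin n → ℂ :=
  fun j => ⟨x 0 j.succ, x j.succ 0⟩

/-- The equivalence `x ↦ (hermTail x, (hermRow x, x 0 0))`. -/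
def hermPeel (n : ℕ) : HermCoord (n + 1) ≃ᵐ HermCoord n × ((Fin n → ℂ) × ℝ) :=
  (MeasurableEquiv.piFinSuccAbove (fun _ => Fin (n + 1) → ℝ) 0).trans <|
  ((MeasurableEquiv.piFinSuccAbove (fun _ => ℝ) 0).prodCongr
    ((MeasurableEquiv.piCongrRight fun _ : Fin n =>
      MeasurableEquiv.piFinSuccAbove (fun _ => ℝ) 0).trans
        (MeasurableEquiv.arrowProdEquivProdArrow ℝ (Fin n → ℝ) (Fin n)))).trans <|
  MeasurableEquiv.prodAssoc.symm.trans <|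
  MeasurableEquiv.prodComm.trans <|
  (MeasurableEquiv.refl (Fin n → Fin n → ℝ)).prodCongr <|
  MeasurableEquiv.prodAssoc.trans <|
  MeasurableEquiv.prodComm.trans <|
  ((MeasurableEquiv.arrowProdEquivProdArrow ℝ ℝ (Fin n)).symm.trans
    (MeasurableEquiv.piCongrRight fun _ : Fin n => Complex.measurableEquivRealProd.symm)).prodCongr
  (MeasurableEquiv.refl ℝ)

/-- Each factor of `hermPeel` only regroups coordinates or identifies ℝ × ℝ with ℂ, so no constant
appears. -/
theorem measurePreserving_hermPeel (n : ℕ) : MeasurePreserving (hermPeel n) volume volume := by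
  have swap : ∀ (α β : Type) [MeasureSpace α] [MeasureSpace β]
      [SigmaFinite (volume : Measure α)] [SigmaFinite (volume : Measure β)],
      MeasurePreserving (MeasurableEquiv.prodComm : α × β ≃ᵐ β × α) volume volume :=
    fun _ _ => Measure.measurePreserving_swap
  refine MeasurePreserving.trans (volume_preserving_piFinSuccAbove _ 0) ?_
  refine MeasurePreserving.trans ((volume_preserving_piFinSuccAbove _ 0).prod
    ((volume_preserving_pi fun _ => volume_preserving_piFinSuccAbove _ 0).trans
      (volume_measurePreserving_arrowProdEquivProdArrow _ _ _))) ?_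
  refine MeasurePreserving.trans volume_preserving_prodAssoc.symm ?_
  refine MeasurePreserving.trans (swap _ _) ?_
  refine MeasurePreserving.prod (MeasurePreserving.id _) ?_
  refine MeasurePreserving.trans volume_preserving_prodAssoc ?_
  refine MeasurePreserving.trans (swap _ _) ?_
  refine MeasurePreserving.prod (MeasurePreserving.trans
    (volume_measurePreserving_arrowProdEquivProdArrow _ _ _).symm ?_) (MeasurePreserving.id _)
  exact volume_preserving_pi fun _ => Complex.volume_preserving_equiv_real_prod.symm

/-- The `(n+1) × (n+1)` Hermitian matrix with corner `u`, first row `y` and lower block `W`. -/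
def bordered {n : ℕ} (u : ℝ) (y : Fin n → ℂ) (W : Matrix (Fin n) (Fin n) ℂ) :
    Matrix (Unit ⊕ Fin n) (Unit ⊕ Fin n) ℂ :=
  Matrix.fromBlocks (Matrix.of fun _ _ => (u : ℂ)) (Matrix.replicateRow Unit y)
    (Matrix.replicateRow Unit y).conjTranspose W

/-- The quadratic form `y W⁻¹ y*`. -/
def invForm {n : ℕ} (W : Matrix (Fin n) (Fin n) ℂ) (y : Fin n → ℂ) : ℂ :=
  y ⬝ᵥ W⁻¹.mulVec (star y)

theorem replicateRow_invForm {n : ℕ} (W : Matrix (Fin n) (Fin n) ℂ) (y : Fin n → ℂ) :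
    Matrix.replicateRow Unit y * W⁻¹ * (Matrix.replicateRow Unit y).conjTranspose =
      Matrix.of fun _ _ => invForm W y := by
  ext i j
  simp [invForm, Matrix.mul_apply, dotProduct, Matrix.mulVec, Finset.sum_mul, Finset.mul_sum]
  rw [Finset.sum_comm]
  simp [mul_assoc]

theorem bordered_det {n : ℕ} (u : ℝ) (y : Fin n → ℂ) {W : Matrix (Fin n) (Fin n) ℂ}
    (hW : W.PosDef) : (bordered u y W).det = W.det * (u - invForm W y) := by
  have := hW.isUnit.invertible
  rw [bordered, Matrix.det_fromBlocks₂₂, Matrix.invOf_eq_nonsing_inv, replicateRow_invForm]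
  simp

/-- Semidefiniteness is decided by the Schur complement. Strictness is then a matter of the
determinant, which `bordered_det` factors. -/
theorem bordered_posDef {n : ℕ} (u : ℝ) (y : Fin n → ℂ) (W : Matrix (Fin n) (Fin n) ℂ) :
    (bordered u y W).PosDef ↔ W.PosDef ∧ 0 < u - invForm W y := by
  by_cases hW : W.PosDef
  · have := hW.isUnit.invertible
    have hps : (bordered u y W).PosSemidef ↔ 0 ≤ u - invForm W y := by
      rw [bordered, Matrix.PosDef.fromBlocks₂₂ _ _ hW, replicateRow_invForm]
      rw [show (Matrix.of fun _ _ : Unit => (u : ℂ)) - (Matrix.of fun _ _ => invForm W y) =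
        Matrix.diagonal fun _ => (u - invForm W y) by ext; simp, Matrix.posSemidef_diagonal_iff]
      simp
    simp only [hW, true_and]
    constructor
    · intro h
      have := h.det_pos
      rw [bordered_det u y hW] at this
      exact (mul_pos_iff_of_pos_left hW.det_pos).1 this
    · intro h
      refine (hps.2 h.le).posDef_iff_isUnit.2 ?_
      rw [Matrix.isUnit_iff_isUnit_det, bordered_det u y hW]
      exact (mul_pos hW.det_pos h).ne'.isUnit
  · simp only [hW, false_and, iff_false]
    intro h
    exact hW (h.submatrix (e := Sum.inr) Sum.inr_injective)

/-- The splitting of the index `0` off `Fin (n+1)`. -/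
def finSplit (n : ℕ) : Unit ⊕ Fin n ≃ Fin (n + 1) :=
  (Equiv.sumComm _ _).trans ((Equiv.optionEquivSumPUnit (Fin n)).symm.trans (finSuccEquiv n).symm)

theorem finSplit_inl (n : ℕ) (i : Unit) : finSplit n (Sum.inl i) = 0 := by
  simp [finSplit]

theorem finSplit_inr (n : ℕ) (i : Fin n) : finSplit n (Sum.inr i) = i.succ := by
  simp [finSplit]

theorem herm_submatrix {n : ℕ} (x : HermCoord (n + 1)) :
    (herm x).submatrix (finSplit n) (finSplit n) =
      bordered (x 0 0) (hermRow x) (herm (hermTail x)) := by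
  ext i j
  rcases i with i | i <;> rcases j with j | j <;>
    simp [finSplit_inl, finSplit_inr, bordered, herm, hermRow, hermTail, Fin.succ_ne_zero,
      Complex.ext_iff, (Fin.succ_ne_zero _).symm]

theorem one_sub_herm_submatrix {n : ℕ} (x : HermCoord (n + 1)) :
    (1 - herm x).submatrix (finSplit n) (finSplit n) =
      bordered (1 - x 0 0) (-hermRow x) (1 - herm (hermTail x)) := by
  have h : (1 - herm x).submatrix (finSplit n) (finSplit n) =
      1 - (herm x).submatrix (finSplit n) (finSplit n) := by
    rw [← Matrix.submatrix_one_equiv (finSplit n)]; rfl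
  rw [h, herm_submatrix]
  ext i j
  rcases i with i | i <;> rcases j with j | j <;> simp [bordered, Matrix.one_apply]

theorem posDef_submatrix_equiv {m n : Type*} {M : Matrix n n ℂ} (e : m ≃ n) :
    (M.submatrix e e).PosDef ↔ M.PosDef :=
  ⟨fun h => by simpa using h.submatrix e.symm.injective, fun h => h.submatrix e.injective⟩

theorem invForm_neg {n : ℕ} (W : Matrix (Fin n) (Fin n) ℂ) (y : Fin n → ℂ) :
    invForm W (-y) = invForm W y := by
  simp [invForm, Matrix.mulVec_neg]

/-- Over a fixed lower block W the domain is the set of (y, u) with yW⁻¹y* < u < 1 - y(1-W)⁻¹y*. The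
row of 1 - U is -y, but the form is even. -/
theorem mem_betaDomain_succ {n : ℕ} (x : HermCoord (n + 1)) :
    x ∈ betaDomain (n + 1) ↔ hermTail x ∈ betaDomain n ∧
      0 < x 0 0 - invForm (herm (hermTail x)) (hermRow x) ∧
      0 < (1 - x 0 0 : ℝ) - invForm (1 - herm (hermTail x)) (hermRow x) := by
  rw [betaDomain, Set.mem_ofPred_eq, ← posDef_submatrix_equiv (finSplit n),
    ← posDef_submatrix_equiv (M := 1 - herm x) (finSplit n), herm_submatrix,
    one_sub_herm_submatrix, bordered_posDef, bordered_posDef, invForm_neg]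
  simp only [betaDomain, Set.mem_ofPred_eq]
  tauto

theorem herm_det_succ {n : ℕ} (x : HermCoord (n + 1)) (h : (herm (hermTail x)).PosDef) :
    (herm x).det = (herm (hermTail x)).det *
      (x 0 0 - invForm (herm (hermTail x)) (hermRow x)) := by
  rw [← Matrix.det_submatrix_equiv_self (finSplit n), herm_submatrix, bordered_det _ _ h]

theorem one_sub_herm_det_succ {n : ℕ} (x : HermCoord (n + 1))
    (h : (1 - herm (hermTail x)).PosDef) :
    (1 - herm x).det = (1 - herm (hermTail x)).det *
      ((1 - x 0 0 : ℝ) - invForm (1 - herm (hermTail x)) (hermRow x)) := by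
  rw [← Matrix.det_submatrix_equiv_self (finSplit n), one_sub_herm_submatrix, bordered_det _ _ h,
    invForm_neg]

theorem invForm_eq_ofReal {n : ℕ} {W : Matrix (Fin n) (Fin n) ℂ} (hW : W.PosDef)
    (y : Fin n → ℂ) : invForm W y = ((invForm W y).re : ℂ) := by
  have := hW.inv.posSemidef.dotProduct_mulVec_nonneg (star y)
  rw [star_star] at this
  exact (Complex.eq_re_of_ofReal_le (r := 0) (by simpa [invForm] using this))

/-- W⁻¹ + (1-W)⁻¹ = W⁻¹(1-W)⁻¹ is positive definite, hence of the form B*B. In the variable η = By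
the interval for u has length 1 - |η|², which is the Dirichlet domain, and the determinant gives the
Jacobian of this substitution. -/
theorem exists_sum_invForm {n : ℕ} {W : Matrix (Fin n) (Fin n) ℂ} (h₁ : W.PosDef)
    (h₂ : (1 - W).PosDef) :
    ∃ B : Matrix (Fin n) (Fin n) ℂ,
      (Complex.normSq B.det : ℂ) = (W.det * (1 - W).det)⁻¹ ∧
      ∀ y, (invForm W y).re + (invForm (1 - W) y).re = ∑ i, ‖B.mulVec y i‖ ^ 2 := by
  have hH := h₁.inv.add h₂.inv
  open scoped MatrixOrder in
  obtain ⟨B, hB⟩ := CStarAlgebra.nonneg_iff_eq_star_mul_self.mp hH.posSemidef.nonneg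
  have u₁ := (Matrix.isUnit_iff_isUnit_det _).1 h₁.isUnit
  have u₂ := (Matrix.isUnit_iff_isUnit_det _).1 h₂.isUnit
  -- `invForm` conjugates its right argument, so the factor that acts on y itself is the entrywise
  -- conjugate of `B`.
  refine ⟨B.map star, ?_, fun y => ?_⟩
  · have e : W⁻¹ + (1 - W)⁻¹ = W⁻¹ * (1 - W)⁻¹ := by
      have : W⁻¹ * ((1 - W) + W) * (1 - W)⁻¹ = W⁻¹ + (1 - W)⁻¹ := by
        rw [mul_add, add_mul, mul_assoc, Matrix.mul_nonsing_inv _ u₂, Matrix.nonsing_inv_mul _ u₁]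
        simp
      rw [← this]; simp
    have d := congrArg Matrix.det hB
    rw [e, Matrix.det_mul, Matrix.det_mul, Matrix.det_nonsing_inv, Matrix.det_nonsing_inv, Ring.inverse_eq_inv',
      Matrix.star_eq_conjTranspose,
      Matrix.det_conjTranspose] at d
    have hd : (B.map star).det = star B.det :=
      (Matrix.det_transpose B.conjTranspose).trans (Matrix.det_conjTranspose B)
    rw [hd, mul_inv, d, ← Complex.mul_conj]
    simp
  · have : invForm W y + invForm (1 - W) y = ∑ i, ((‖(B.map star).mulVec y i‖ ^ 2 : ℝ) : ℂ) := by
      rw [invForm, invForm, ← dotProduct_add, ← Matrix.add_mulVec, hB, Matrix.star_eq_conjTranspose,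
        ← Matrix.mulVec_mulVec, Matrix.dotProduct_mulVec, Matrix.vecMul_conjTranspose, dotProduct]
      refine Finset.sum_congr rfl fun i _ => ?_
      have hi : (B.map star).mulVec y i = star ((B.mulVec (star y)) i) := by
        simp [Matrix.mulVec, dotProduct]
      rw [hi, norm_star, ← Complex.normSq_eq_norm_sq, ← Complex.mul_conj, Pi.star_apply, mul_comm]
      rfl
    rw [← Complex.add_re, this, ← Complex.ofReal_sum, Complex.ofReal_re]

/-! ### The recursion for the beta integral -/

theorem continuous_herm (r : ℕ) : Continuous (herm : HermCoord r → Matrix (Fin r) (Fin r) ℂ) := by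
  refine continuous_matrix fun i j => ?_
  simp only [herm, Matrix.of_apply]
  split_ifs <;> fun_prop

theorem herm_isHermitian {r : ℕ} (x : HermCoord r) : (herm x).IsHermitian := by
  ext i j
  rcases lt_trichotomy i j with h | h | h
  · simp [herm, h, h.ne, h.ne', h.not_gt]
  · simp [herm, h]
  · simp [herm, h, h.ne, h.ne', h.not_gt, Complex.ext_iff]

/-- Positive definite means positive semidefinite and invertible: an intersection of closed
conditions, and an open one. -/
theorem measurableSet_posDef {r : ℕ} {M : HermCoord r → Matrix (Fin r) (Fin r) ℂ}
    (hM : Continuous M) (hH : ∀ x, (M x).IsHermitian) :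
    MeasurableSet {x | (M x).PosDef} := by
  have e : {x | (M x).PosDef} =
      (⋂ v : Fin r → ℂ, {x | 0 ≤ star v ⬝ᵥ (M x).mulVec v}) ∩ {x | (M x).det ≠ 0} := by
    ext x
    simp only [Set.mem_inter_iff, Set.mem_iInter, Set.mem_ofPred_eq]
    constructor
    · exact fun h => ⟨fun v => h.posSemidef.dotProduct_mulVec_nonneg v, h.det_pos.ne'⟩
    · rintro ⟨h1, h2⟩
      refine (Matrix.PosSemidef.of_dotProduct_mulVec_nonneg (hH x) h1).posDef_iff_isUnit.2 ?_
      exact (Matrix.isUnit_iff_isUnit_det _).2 h2.isUnit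
  rw [e]
  refine (isClosed_iInter fun v => ?_).measurableSet.inter
    (isOpen_ne_fun hM.matrix_det continuous_const).measurableSet
  exact isClosed_le continuous_const (continuous_const.dotProduct (hM.matrix_mulVec continuous_const))

theorem measurableSet_betaDomain (r : ℕ) : MeasurableSet (betaDomain r) :=
  (measurableSet_posDef (continuous_herm r) herm_isHermitian).inter
    (measurableSet_posDef (continuous_const.sub (continuous_herm r))
      fun x => Matrix.isHermitian_one.sub (herm_isHermitian x))

theorem measurable_betaIntegrand (r : ℕ) (a b : ℂ) : Measurable (betaIntegrand r a b) :=
  ((continuous_herm r).matrix_det.measurable.pow_const _).mul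
    ((continuous_const.sub (continuous_herm r)).matrix_det.measurable.pow_const _)

theorem posDef_det_eq {r : ℕ} {M : Matrix (Fin r) (Fin r) ℂ} (hM : M.PosDef) :
    0 < M.det.re ∧ M.det = (M.det.re : ℂ) := by
  have := Complex.lt_def.1 hM.det_pos
  exact ⟨by simpa using this.1, Complex.ext rfl (by simpa using this.2.symm)⟩

/-- With s = u - yW⁻¹y* one has 1 - s - |By|² = 1 - u - y(1-W)⁻¹y*. The two Schur complements are
thus the arguments of the truncated powers, whose vanishing encodes the domain. -/
theorem indicator_betaIntegrand_succ {n : ℕ} (a b : ℂ) (x : HermCoord (n + 1))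
    (hx : hermTail x ∈ betaDomain n) {B : Matrix (Fin n) (Fin n) ℂ}
    (hB : ∀ y, (invForm (herm (hermTail x)) y).re + (invForm (1 - herm (hermTail x)) y).re =
      ∑ i, ‖B.mulVec y i‖ ^ 2) :
    (betaDomain (n + 1)).indicator (betaIntegrand (n + 1) a b) x =
      betaIntegrand n (a - 1) (b - 1) (hermTail x) * dirichletKernel n (a - n) (b - n)
        (x 0 0 - (invForm (herm (hermTail x)) (hermRow x)).re, B.mulVec (hermRow x)) := by
  obtain ⟨d₁, e₁⟩ := posDef_det_eq hx.1
  obtain ⟨d₂, e₂⟩ := posDef_det_eq hx.2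
  have f₁ := invForm_eq_ofReal hx.1 (hermRow x)
  have f₂ := invForm_eq_ofReal hx.2 (hermRow x)
  have hs := hB (hermRow x)
  set q₁ := (invForm (herm (hermTail x)) (hermRow x)).re
  set q₂ := (invForm (1 - herm (hermTail x)) (hermRow x)).re
  have hmem : x ∈ betaDomain (n + 1) ↔ 0 < x 0 0 - q₁ ∧ 0 < 1 - x 0 0 - q₂ := by
    rw [mem_betaDomain_succ, f₁, f₂]
    simp only [hx, true_and, ← Complex.ofReal_sub]
    norm_cast
  have hk : dirichletKernel n (a - n) (b - n) (x 0 0 - q₁, B.mulVec (hermRow x)) =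
      truncPow (x 0 0 - q₁) (a - n) * truncPow (1 - x 0 0 - q₂) (b - n) := by
    rw [dirichletKernel]
    simp only [← hs]
    congr 2
    ring
  rw [hk]
  by_cases hm : x ∈ betaDomain (n + 1)
  · obtain ⟨p₁, p₂⟩ := hmem.1 hm
    rw [Set.indicator_of_mem hm, truncPow_of_pos p₁, truncPow_of_pos p₂, betaIntegrand,
      betaIntegrand, herm_det_succ x hx.1, one_sub_herm_det_succ x hx.2, f₁, f₂, e₁, e₂,
      ← Complex.ofReal_sub, ← Complex.ofReal_sub,
      Complex.mul_cpow_ofReal_nonneg d₁.le p₁.le, Complex.mul_cpow_ofReal_nonneg d₂.le p₂.le]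
    push_cast
    rw [show a - (n + 1) = a - 1 - n by ring, show b - (n + 1) = b - 1 - n by ring,
      show a - n - 1 = a - 1 - n by ring, show b - n - 1 = b - 1 - n by ring]
    ring
  · rw [Set.indicator_of_notMem hm]
    rw [hmem, not_and_or] at hm
    rcases hm with h | h
    · rw [truncPow_of_nonpos (not_lt.1 h)]; ring
    · rw [truncPow_of_nonpos (not_lt.1 h)]; ring

theorem continuous_invForm_re {n : ℕ} (W : Matrix (Fin n) (Fin n) ℂ) :
    Continuous fun y => (invForm W y).re := by
  unfold invForm
  exact Complex.continuous_re.comp (Continuous.dotProduct continuous_id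
    (continuous_const.matrix_mulVec continuous_star))

/-- The shear `(y, u) ↦ (B y, u - f y)` scales the volume by `|det B|⁻²`. -/
theorem measurePreserving_shear {n : ℕ} {B : Matrix (Fin n) (Fin n) ℂ} (hB : B.det ≠ 0)
    {f : (Fin n → ℂ) → ℝ} (hf : Continuous f) :
    MeasurePreserving (fun v : (Fin n → ℂ) × ℝ => (v.2 - f v.1, B.mulVec v.1)) volume
      (ENNReal.ofReal (Complex.normSq B.det)⁻¹ • volume) := by
  -- The determinant of a complex linear map over ℝ is the norm |det|² of its complex determinant.
  have hdet : LinearMap.det ((Matrix.toLin' B).restrictScalars ℝ) = Complex.normSq B.det := by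
    rw [LinearMap.det_restrictScalars, LinearMap.det_toLin', Algebra.norm_complex_apply]
  have hn := Complex.normSq_pos.2 hB
  have h1 : MeasurePreserving (fun y : Fin n → ℂ => B.mulVec y) volume
      (ENNReal.ofReal (Complex.normSq B.det)⁻¹ • volume) := by
    refine ⟨(continuous_const.matrix_mulVec continuous_id).measurable, ?_⟩
    have := Measure.map_linearMap_addHaar_eq_smul_addHaar (volume : Measure (Fin n → ℂ))
      (f := (Matrix.toLin' B).restrictScalars ℝ) (by rw [hdet]; exact hn.ne')
    rw [hdet, abs_of_pos (inv_pos.2 hn)] at this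
    exact this
  have h2 := MeasurePreserving.skew_product h1 (μc := (volume : Measure ℝ)) (μd := volume)
    (g := fun y u => u - f y) (by exact (by fun_prop : Continuous _).measurable)
    (Filter.Eventually.of_forall fun y => (measurePreserving_sub_right volume (f y)).map_eq)
  have h3 := Measure.measurePreserving_swap
    (μ := (ENNReal.ofReal (Complex.normSq B.det)⁻¹ • volume : Measure (Fin n → ℂ)))
    (ν := (volume : Measure ℝ))
  rw [Measure.prod_smul_right] at h3
  exact h3.comp h2

/-- The integral over one slice, in the form required by Fubini: integrability, value, and value of
the norm. The Jacobian det W · det(1-W) compensates the shift of both exponents by one, so the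
recursion keeps `a` and `b` fixed. -/
theorem slice_betaIntegrand {n : ℕ} {a b : ℂ} (ha : (n : ℝ) < a.re) (hb : (n : ℝ) < b.re)
    {w : HermCoord n} (hw : w ∈ betaDomain n) :
    Integrable (fun v => (betaDomain (n + 1)).indicator (betaIntegrand (n + 1) a b)
        ((hermPeel n).symm (w, v))) ∧
      (∫ v, (betaDomain (n + 1)).indicator (betaIntegrand (n + 1) a b)
        ((hermPeel n).symm (w, v)) = dirichletConst n (a - n) (b - n) * betaIntegrand n a b w) ∧
      ∫ v, ‖(betaDomain (n + 1)).indicator (betaIntegrand (n + 1) a b)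
        ((hermPeel n).symm (w, v))‖ =
          (∫ v, ‖dirichletKernel n (a - n) (b - n) v‖) * ‖betaIntegrand n a b w‖ := by
  obtain ⟨B, hdet, hB⟩ := exists_sum_invForm hw.1 hw.2
  obtain ⟨d₁, e₁⟩ := posDef_det_eq hw.1
  obtain ⟨d₂, e₂⟩ := posDef_det_eq hw.2
  set c := (herm w).det.re * (1 - herm w).det.re with hc
  have hc0 : 0 < c := mul_pos d₁ d₂
  have hnorm : (Complex.normSq B.det)⁻¹ = c := by
    rw [e₁, e₂, ← Complex.ofReal_mul, ← Complex.ofReal_inv] at hdet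
    rw [Complex.ofReal_injective hdet, inv_inv]
  have hB0 : B.det ≠ 0 := by
    intro h
    rw [h] at hnorm
    simp at hnorm
    exact hc0.ne hnorm
  have hmp := measurePreserving_shear hB0 (continuous_invForm_re (herm w))
  rw [hnorm] at hmp
  obtain ⟨hk, hki⟩ := dirichletKernel_integral n (p := a - n) (q := b - n)
    (by simpa using ha) (by simpa using hb)
  set k := dirichletKernel n (a - n) (b - n)
  have hkm : Measurable k := measurable_dirichletKernel n _ _
  set Ψ := fun v : (Fin n → ℂ) × ℝ => (v.2 - (invForm (herm w) v.1).re, B.mulVec v.1)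
  have e : (fun v => (betaDomain (n + 1)).indicator (betaIntegrand (n + 1) a b)
      ((hermPeel n).symm (w, v))) = fun v => betaIntegrand n (a - 1) (b - 1) w * k (Ψ v) := by
    funext v
    have hx := (hermPeel n).apply_symm_apply (w, v)
    have h1 : hermTail ((hermPeel n).symm (w, v)) = w := congrArg Prod.fst hx
    have h2 : hermRow ((hermPeel n).symm (w, v)) = v.1 := congrArg (fun p => p.2.1) hx
    have h3 : (hermPeel n).symm (w, v) 0 0 = v.2 := congrArg (fun p => p.2.2) hx
    rw [indicator_betaIntegrand_succ a b _ (B := B) (by rw [h1]; exact hw)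
      (by rw [h1]; exact hB), h1, h2, h3]
  -- The Jacobian raises the exponents a-1-n and b-1-n to a-n and b-n.
  have hf : betaIntegrand n a b w = c * betaIntegrand n (a - 1) (b - 1) w := by
    have cp : ∀ (z s : ℂ), z ≠ 0 → z ^ (s - n) = z * z ^ (s - 1 - n) := by
      intro z s hz
      rw [show s - n = (s - 1 - n) + 1 by ring, Complex.cpow_add _ _ hz, Complex.cpow_one, mul_comm]
    rw [betaIntegrand, betaIntegrand, cp _ _ hw.1.det_pos.ne', cp _ _ hw.2.det_pos.ne', hc]
    push_cast
    rw [← e₁, ← e₂]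
    ring
  have int : ∀ {E : Type} [NormedAddCommGroup E] [NormedSpace ℝ E] (g : ℝ × (Fin n → ℂ) → E),
      AEStronglyMeasurable g → ∫ v, g (Ψ v) = c • ∫ v, g v := by
    intro E _ _ g hg
    rw [← integral_map (μ := volume) (φ := Ψ) (f := g) hmp.measurable.aemeasurable, hmp.map_eq,
      integral_smul_measure, ENNReal.toReal_ofReal hc0.le]
    rw [hmp.map_eq]
    exact hg.smul_measure _
  refine ⟨?_, ?_, ?_⟩
  · rw [e]
    refine Integrable.const_mul ?_ _
    exact (hmp.integrable_comp (hkm.aestronglyMeasurable)).2 (hk.smul_measure ENNReal.ofReal_ne_top)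
  · rw [e, integral_const_mul, int k hkm.aestronglyMeasurable, hki, hf, Complex.real_smul]
    ring
  · have e' := congrArg (fun g : (Fin n → ℂ) × ℝ → ℂ => fun v => ‖g v‖) e
    simp only [norm_mul] at e'
    rw [e', integral_const_mul, int (fun v => ‖k v‖) hkm.norm.aestronglyMeasurable, hf, norm_mul,
      Complex.norm_real, Real.norm_of_nonneg hc0.le, smul_eq_mul]
    ring

theorem indicator_betaIntegrand_succ_of_notMem {n : ℕ} (a b : ℂ) {w : HermCoord n}
    (hw : w ∉ betaDomain n) (v : (Fin n → ℂ) × ℝ) :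
    (betaDomain (n + 1)).indicator (betaIntegrand (n + 1) a b) ((hermPeel n).symm (w, v)) = 0 := by
  refine Set.indicator_of_notMem (fun h => hw ?_) _
  have hx : hermTail ((hermPeel n).symm (w, v)) = w :=
    congrArg Prod.fst ((hermPeel n).apply_symm_apply (w, v))
  rw [← hx]
  exact ((mem_betaDomain_succ _).1 h).1

theorem betaIntegrand_succ {n : ℕ} {a b : ℂ} (ha : (n : ℝ) < a.re) (hb : (n : ℝ) < b.re)
    (hI : IntegrableOn (betaIntegrand n a b) (betaDomain n)) :
    IntegrableOn (betaIntegrand (n + 1) a b) (betaDomain (n + 1)) ∧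
      hermBeta (n + 1) a b = dirichletConst n (a - n) (b - n) * hermBeta n a b := by
  have hmp := (measurePreserving_hermPeel n).symm
  set F := (betaDomain (n + 1)).indicator (betaIntegrand (n + 1) a b) with hF
  have hFm : Measurable F :=
    (measurable_betaIntegrand _ _ _).indicator (measurableSet_betaDomain _)
  set G := fun p => F ((hermPeel n).symm p) with hG
  have hGm : Measurable G := hFm.comp (hermPeel n).symm.measurable
  have hI' := (integrable_indicator_iff (measurableSet_betaDomain n)).2 hI
  have hGi : Integrable G := by
    rw [Measure.volume_eq_prod, integrable_prod_iff hGm.aestronglyMeasurable]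
    constructor
    · refine Filter.Eventually.of_forall fun w => ?_
      by_cases hw : w ∈ betaDomain n
      · exact (slice_betaIntegrand ha hb hw).1
      · simp only [hG, hF, indicator_betaIntegrand_succ_of_notMem a b hw]
        exact integrable_zero _ _ _
    · refine (hI'.norm.const_mul (∫ v, ‖dirichletKernel n (a - n) (b - n) v‖)).congr
        (Filter.Eventually.of_forall fun w => ?_)
      by_cases hw : w ∈ betaDomain n
      · simp only [hG, hF, (slice_betaIntegrand ha hb hw).2.2, Set.indicator_of_mem hw]
      · simp only [hG, hF, indicator_betaIntegrand_succ_of_notMem a b hw,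
          Set.indicator_of_notMem hw]
        simp
  constructor
  · rw [← integrable_indicator_iff (measurableSet_betaDomain _), ← hF,
      ← hmp.integrable_comp_emb (hermPeel n).symm.measurableEmbedding]
    exact hGi
  · rw [hermBeta, ← integral_indicator (measurableSet_betaDomain _), ← hF,
      ← hmp.integral_comp (hermPeel n).symm.measurableEmbedding F, hermBeta,
      ← integral_indicator (measurableSet_betaDomain _), ← integral_const_mul,
      Measure.volume_eq_prod, integral_prod _ hGi]
    refine integral_congr_ae (Filter.Eventually.of_forall fun w => ?_)
    by_cases hw : w ∈ betaDomain n
    · simp only [hG, hF, (slice_betaIntegrand ha hb hw).2.1, Set.indicator_of_mem hw]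
    · simp only [hG, hF, indicator_betaIntegrand_succ_of_notMem a b hw,
          Set.indicator_of_notMem hw]
      simp

/-- For r = 0 the space is a point with the Dirac measure. -/
theorem hermBeta_zero (a b : ℂ) :
    IntegrableOn (betaIntegrand 0 a b) (betaDomain 0) ∧ hermBeta 0 a b = 1 := by
  have hu : betaDomain 0 = Set.univ := by
    ext x
    simp only [betaDomain, Set.mem_ofPred_eq, Set.mem_univ, iff_true]
    have : ∀ M : Matrix (Fin 0) (Fin 0) ℂ, M.PosDef := fun M => by
      rw [Subsingleton.elim M 1]; exact Matrix.PosDef.one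
    exact ⟨this _, this _⟩
  have hf : betaIntegrand 0 a b = fun _ => 1 := by
    funext x; simp [betaIntegrand]
  have hv : (volume : Measure (HermCoord 0)) = Measure.dirac 0 := Measure.volume_pi_eq_dirac 0
  constructor
  · rw [hu, hf, hv]
    simp
  · rw [hermBeta, hu, hf, hv]
    simp

/-- Closed form of the beta integral, together with its convergence. -/
theorem hermBeta_eq_prod (r : ℕ) {a b : ℂ} (ha : (r : ℝ) - 1 < a.re) (hb : (r : ℝ) - 1 < b.re) :
    IntegrableOn (betaIntegrand r a b) (betaDomain r) ∧
      hermBeta r a b = ∏ n ∈ Finset.range r, dirichletConst n (a - n) (b - n) := by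
  induction r with
  | zero => simpa using hermBeta_zero a b
  | succ n ih =>
    push_cast at ha hb
    obtain ⟨h1, h2⟩ := ih (by linarith) (by linarith)
    obtain ⟨h3, h4⟩ := betaIntegrand_succ (n := n) (a := a) (b := b) (by linarith) (by linarith) h1
    exact ⟨h3, by rw [h4, h2, Finset.prod_range_succ, mul_comm]⟩

/-! ### Contiguity relations of the beta integral -/

theorem dirichletConst_add_one_left (n : ℕ) {p q : ℂ} (hp : 0 < p.re) (hq : 0 < q.re) :
    (p + q + n) * dirichletConst n (p + 1) q = p * dirichletConst n p q := by
  have hp0 : p ≠ 0 := by rintro rfl; simp at hp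
  have hre : 0 < (p + q + n).re := by
    simp only [Complex.add_re, Complex.natCast_re]; positivity
  have hs : p + q + n ≠ 0 := by intro h; rw [h] at hre; simp at hre
  have hG := Complex.Gamma_ne_zero_of_re_pos hre
  rw [dirichletConst, dirichletConst, Complex.Gamma_add_one p hp0,
    show p + 1 + q + n = p + q + n + 1 by ring, Complex.Gamma_add_one _ hs]
  field_simp

theorem dirichletConst_comm (n : ℕ) (p q : ℂ) : dirichletConst n p q = dirichletConst n q p := by
  rw [dirichletConst, dirichletConst, add_comm p q, mul_comm (Complex.Gamma p)]

theorem hermBeta_comm (r : ℕ) {a b : ℂ} (ha : (r : ℝ) - 1 < a.re) (hb : (r : ℝ) - 1 < b.re) :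
    hermBeta r a b = hermBeta r b a := by
  rw [(hermBeta_eq_prod r ha hb).2, (hermBeta_eq_prod r hb ha).2]
  exact Finset.prod_congr rfl fun n _ => dirichletConst_comm _ _ _

/-- In the n-th factor of the product p = a-n and q = b-n, so p + q + n = a+b-n. The ratios
p/(p+q+n) multiply to the quotient of falling factorials. -/
theorem fallFun_mul_hermBeta_add_one_left (r : ℕ) {a b : ℂ} (ha : (r : ℝ) - 1 < a.re)
    (hb : (r : ℝ) - 1 < b.re) :
    fallFun r (a + b) * hermBeta r (a + 1) b = fallFun r a * hermBeta r a b := by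
  rw [(hermBeta_eq_prod r ha hb).2, (hermBeta_eq_prod r (a := a + 1)
    (by simp only [Complex.add_re, Complex.one_re]; linarith) hb).2, fallFun, fallFun,
    ← Finset.prod_mul_distrib, ← Finset.prod_mul_distrib]
  refine Finset.prod_congr rfl fun n hn => ?_
  have hn' : (n : ℝ) + 1 ≤ r := by exact_mod_cast Finset.mem_range.1 hn
  have := dirichletConst_add_one_left n (p := a - n) (q := b - n)
    (by simp only [Complex.sub_re, Complex.natCast_re]; linarith)
    (by simp only [Complex.sub_re, Complex.natCast_re]; linarith)
  rw [← this]
  ring_nf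

theorem fallFun_mul_hermBeta_add_one_right (r : ℕ) {a b : ℂ} (ha : (r : ℝ) - 1 < a.re)
    (hb : (r : ℝ) - 1 < b.re) :
    fallFun r (a + b) * hermBeta r a (b + 1) = fallFun r b * hermBeta r a b := by
  rw [hermBeta_comm r ha hb, hermBeta_comm r (b := b + 1) ha
    (by simp only [Complex.add_re, Complex.one_re]; linarith), add_comm a b]
  exact fallFun_mul_hermBeta_add_one_left r hb ha

theorem fallFun_ne_zero {r : ℕ} {s : ℂ} (hs : (r : ℝ) - 1 < s.re) : fallFun r s ≠ 0 := by
  refine Finset.prod_ne_zero_iff.2 fun k hk h => ?_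
  have hk' : (k : ℝ) + 1 ≤ r := by exact_mod_cast Finset.mem_range.1 hk
  have := congrArg Complex.re h
  simp only [Complex.sub_re, Complex.natCast_re, Complex.zero_re] at this
  linarith

theorem bFun_add_one (r : ℕ) (s : ℂ) : bFun r (s + 1) = fallFun r (s + r) := by
  rw [bFun, fallFun, ← Finset.prod_range_reflect]
  refine Finset.prod_congr rfl fun k hk => ?_
  have hk' := Finset.mem_range.1 hk
  rw [Nat.sub_sub, Nat.cast_sub (by omega)]
  push_cast
  ring

theorem bFun_neg (r : ℕ) (s : ℂ) : bFun r (-s) = (-1) ^ r * fallFun r s := by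
  rw [bFun, fallFun, ← Finset.card_range r, ← Finset.prod_const, Finset.card_range,
    ← Finset.prod_mul_distrib]
  exact Finset.prod_congr rfl fun k _ => by ring

/-- The sign `σ_{ij}`. -/
def rootSign (r : ℕ) (i j : Fin 3) : ℂ := if i = 0 ∨ j = 0 then (-1) ^ r else 1

/-- In terms of a = α⁽²⁾+r and b = α⁽³⁾+r the first exponent is -(a+b). A pair containing the first
block shifts only one of a, b and is a single relation for B_r. The other two pairs raise one and
lower the other, which composes two relations. -/
theorem hermBeta_contiguity {r : ℕ} (hr : 0 < r) {α : Fin 3 → ℂ} (hα : Admissible r α)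
    {i j : Fin 3} (hij : i ≠ j) (hs : Admissible r (shift α i j)) :
    rootSign r i j * bFun r (α i + 1) * hermBeta r (α 1 + r) (α 2 + r) =
      bFun r (α j) * hermBeta r (shift α i j 1 + r) (shift α i j 2 + r) := by
  have hr1 : (1 : ℝ) ≤ r := by exact_mod_cast hr
  obtain ⟨h0, h1, h2⟩ := hα
  obtain ⟨-, h3, h4⟩ := hs
  rw [Fin.sum_univ_three] at h0
  obtain ⟨a, ha⟩ : ∃ a, a = α 1 + r := ⟨_, rfl⟩
  obtain ⟨b, hb⟩ : ∃ b, b = α 2 + r := ⟨_, rfl⟩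
  have e1 : α 1 = a - r := by rw [ha]; ring
  have e2 : α 2 = b - r := by rw [hb]; ring
  have e0 : α 0 = -(a + b) := by rw [ha, hb]; linear_combination h0
  have b0 : bFun r (α 0) = (-1) ^ r * fallFun r (a + b) := by rw [e0, bFun_neg]
  have b0' : bFun r (α 0 + 1) = (-1) ^ r * fallFun r (a + b - 1) := by
    rw [← bFun_neg, e0]; ring_nf
  have b1 : bFun r (α 1) = fallFun r (a - 1) := by
    rw [show α 1 = (α 1 - 1) + 1 by ring, bFun_add_one, e1]; ring_nf
  have b1' : bFun r (α 1 + 1) = fallFun r a := by rw [bFun_add_one, ← ha]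
  have b2 : bFun r (α 2) = fallFun r (b - 1) := by
    rw [show α 2 = (α 2 - 1) + 1 by ring, bFun_add_one, e2]; ring_nf
  have b2' : bFun r (α 2 + 1) = fallFun r b := by rw [bFun_add_one, ← hb]
  have A : (r : ℝ) - 1 < a.re := by rw [ha]; simp only [Complex.add_re, Complex.natCast_re]; linarith
  have B : (r : ℝ) - 1 < b.re := by rw [hb]; simp only [Complex.add_re, Complex.natCast_re]; linarith
  have sgn : ((-1 : ℂ) ^ r) * (-1) ^ r = 1 := by rw [← mul_pow]; simp
  have ar : (α 1).re = a.re - r := by rw [e1]; simp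
  have br : (α 2).re = b.re - r := by rw [e2]; simp
  have a1 : α 1 - 1 + r = a - 1 := by rw [e1]; ring
  have a2 : α 1 + 1 + r = a + 1 := by rw [e1]; ring
  have c1 : α 2 - 1 + r = b - 1 := by rw [e2]; ring
  have c2 : α 2 + 1 + r = b + 1 := by rw [e2]; ring
  -- The shift relations read downwards, from a to a-1 and from b to b-1.
  have L : ∀ {a b : ℂ}, (r : ℝ) < a.re → (r : ℝ) - 1 < b.re →
      fallFun r (a + b - 1) * hermBeta r a b = fallFun r (a - 1) * hermBeta r (a - 1) b := by
    intro a b h h'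
    have := fallFun_mul_hermBeta_add_one_left r (a := a - 1) (b := b)
      (by simp only [Complex.sub_re, Complex.one_re]; linarith) h'
    rwa [sub_add_cancel, show a - 1 + b = a + b - 1 by ring] at this
  have R : ∀ {a b : ℂ}, (r : ℝ) - 1 < a.re → (r : ℝ) < b.re →
      fallFun r (a + b - 1) * hermBeta r a b = fallFun r (b - 1) * hermBeta r a (b - 1) := by
    intro a b h h'
    have := fallFun_mul_hermBeta_add_one_right r (a := a) (b := b - 1) h
      (by simp only [Complex.sub_re, Complex.one_re]; linarith)
    rwa [sub_add_cancel, show a + (b - 1) = a + b - 1 by ring] at this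
  -- The common factor cancelled in the two composite cases. Admissibility of the lowered parameter
  -- gives the strict bound by r, and r ≥ 1 does the rest.
  have hne : ∀ {a b : ℂ}, (r : ℝ) - 1 < a.re → (r : ℝ) - 1 < b.re →
      (r : ℝ) < a.re ∨ (r : ℝ) < b.re → fallFun r (a + b - 1) ≠ 0 := by
    intro a b h h' h''
    refine fallFun_ne_zero ?_
    simp only [Complex.sub_re, Complex.add_re, Complex.one_re]
    rcases h'' with h'' | h'' <;> linarith
  fin_cases i <;> fin_cases j <;>
    simp [shift, rootSign, b0, b0', b1, b1', b2, b2', ← ha, ← hb, a1, a2, c1, c2,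
      ar, br] at hij h3 h4 ⊢
  · rw [← mul_assoc, sgn, one_mul]
    exact L h3 B
  · rw [← mul_assoc, sgn, one_mul]
    exact R A h4
  · linear_combination -(-1) ^ r * fallFun_mul_hermBeta_add_one_left r A B
  -- Both sides are compared with B_r(a, b-1): one step up in b, one step up in a.
  · have h := fallFun_mul_hermBeta_add_one_left r (a := a) (b := b - 1) A
      (by simp only [Complex.sub_re, Complex.one_re]; linarith)
    rw [show a + (b - 1) = a + b - 1 by ring] at h
    refine mul_left_cancel₀ (hne A B (Or.inr h4)) ?_
    linear_combination fallFun r a * R A h4 - fallFun r (b - 1) * h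
  · linear_combination -(-1) ^ r * fallFun_mul_hermBeta_add_one_right r A B
  · have h := fallFun_mul_hermBeta_add_one_right r (a := a - 1) (b := b)
      (by simp only [Complex.sub_re, Complex.one_re]; linarith) B
    rw [show a - 1 + b = a + b - 1 by ring] at h
    refine mul_left_cancel₀ (hne A B (Or.inl h3)) ?_
    linear_combination fallFun r b * L h3 B - fallFun r (a - 1) * h

/-! ### The Jacobian of the cell -/

/-- The matrix of partial derivatives of the entries of `herm x`. -/
def hermMatrix (r : ℕ) : Matrix (Fin r × Fin r) (Fin r × Fin r) ℂ :=
  Matrix.of fun kl ij => herm (Pi.single ij.1 (Pi.single ij.2 1)) kl.1 kl.2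

theorem card_lower (r : ℕ) :
    Fintype.card {kl : Fin r × Fin r // ¬ kl.1 ≤ kl.2} = r * (r - 1) / 2 := by
  rw [Fintype.card_subtype, ← Finset.sum_range_id, ← Fin.sum_univ_eq_sum_range (fun i => i)]
  rw [Finset.card_filter, Fintype.sum_prod_type]
  refine Finset.sum_congr rfl fun k _ => ?_
  rw [← Finset.card_filter]
  simp only [not_le]
  rw [show (Finset.univ.filter fun l : Fin r => l < k) = Finset.Iio k by ext; simp, Fin.card_Iio]

theorem single_single_apply {r : ℕ} (i j k l : Fin r) :
    (Pi.single i (Pi.single j 1) : HermCoord r) k l = if k = i ∧ l = j then 1 else 0 := by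
  by_cases h : k = i
  · subst h; by_cases h' : l = j <;> simp [h']
  · simp [h]

/-- Subtracting U_{lk} from U_{kl} for l < k leaves -2i times the imaginary coordinate. After these
unipotent row operations the matrix is block triangular, with the identity on k ≤ l and -2i on each
of the r(r-1)/2 places below the diagonal. Rows and columns carry the same index set, so no
reordering sign occurs. -/
theorem det_hermMatrix (r : ℕ) : (hermMatrix r).det = (-2 * Complex.I) ^ (r * (r - 1) / 2) := by
  -- `P` subtracts the row (l,k) from the row (k,l) whenever l < k.
  set P : Matrix (Fin r × Fin r) (Fin r × Fin r) ℂ := Matrix.of fun kl mn =>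
    (if kl = mn then 1 else 0) - if kl.2 < kl.1 ∧ mn = (kl.2, kl.1) then 1 else 0 with hP
  have hPd : P.det = 1 := by
    rw [Matrix.twoBlockTriangular_det P fun kl => kl.2 < kl.1]
    · have h1 : P.toSquareBlockProp (fun kl => kl.2 < kl.1) = 1 := by
        ext ⟨⟨a, b⟩, hi⟩ ⟨⟨c, d⟩, hj⟩
        simp only [Matrix.toSquareBlockProp, Matrix.toBlock, hP, Matrix.of_apply,
          Matrix.submatrix_apply, Matrix.one_apply, Subtype.mk.injEq, Prod.mk.injEq] at hi hj ⊢
        rw [if_neg (c := b < a ∧ _), sub_zero]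
        rintro ⟨-, rfl, rfl⟩
        exact hi.asymm hj
      have h2 : P.toSquareBlockProp (fun kl => ¬ kl.2 < kl.1) = 1 := by
        ext ⟨⟨a, b⟩, hi⟩ ⟨⟨c, d⟩, hj⟩
        simp only [Matrix.toSquareBlockProp, Matrix.toBlock, hP, Matrix.of_apply,
          Matrix.submatrix_apply, Matrix.one_apply, Subtype.mk.injEq, Prod.mk.injEq] at hi hj ⊢
        rw [if_neg (c := b < a ∧ _), sub_zero]
        exact fun h => hi h.1
      rw [h1, h2]; simp
    · rintro ⟨a, b⟩ hi ⟨c, d⟩ hj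
      simp only [hP, Matrix.of_apply, Prod.mk.injEq] at hi hj ⊢
      rw [if_neg, if_neg, sub_zero]
      · exact fun h => hi h.1
      · rintro ⟨rfl, rfl⟩; exact hi hj
  have hN : ∀ k l i j, (P * hermMatrix r) (k, l) (i, j) = hermMatrix r (k, l) (i, j) -
      if l < k then hermMatrix r (l, k) (i, j) else 0 := by
    intro k l i j
    simp only [Matrix.mul_apply, hP, Matrix.of_apply, sub_mul, Finset.sum_sub_distrib, ite_mul,
      one_mul, zero_mul, Finset.sum_ite_eq, Finset.mem_univ, if_true]
    by_cases h : l < k <;> simp [h]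
  have hNl : ∀ k l i j, l < k → (P * hermMatrix r) (k, l) (i, j) =
      if k = i ∧ l = j then -2 * Complex.I else 0 := by
    intro k l i j h
    rw [hN, if_pos h]
    simp only [hermMatrix, Matrix.of_apply, herm, h.ne, h.ne', h, h.not_gt, if_true, if_false,
      single_single_apply]
    by_cases h' : k = i ∧ l = j <;> simp [h']
    ring
  have hNu : ∀ k l i j, k ≤ l → i ≤ j → (P * hermMatrix r) (k, l) (i, j) =
      if k = i ∧ l = j then 1 else 0 := by
    intro k l i j h h'
    rw [hN, if_neg h.not_gt]
    simp only [hermMatrix, Matrix.of_apply, herm, single_single_apply]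
    rcases h.lt_or_eq with h1 | rfl
    · rw [if_neg h1.ne, if_pos h1, if_neg (c := l = i ∧ k = j)]
      · split_ifs <;> simp
      · rintro ⟨rfl, rfl⟩; exact h1.not_ge h'
    · split_ifs <;> simp_all
  have hdet : (P * hermMatrix r).det = (-2 * Complex.I) ^ (r * (r - 1) / 2) := by
    rw [Matrix.twoBlockTriangular_det _ fun kl => kl.1 ≤ kl.2]
    · have h1 : (P * hermMatrix r).toSquareBlockProp (fun kl => kl.1 ≤ kl.2) = 1 := by
        ext ⟨⟨a, b⟩, hi⟩ ⟨⟨c, d⟩, hj⟩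
        refine (hNu a b c d hi hj).trans ?_
        simp [Matrix.one_apply]
      have h2 : (P * hermMatrix r).toSquareBlockProp (fun kl => ¬ kl.1 ≤ kl.2) =
          Matrix.diagonal fun _ => -2 * Complex.I := by
        ext ⟨⟨a, b⟩, hi⟩ ⟨⟨c, d⟩, hj⟩
        refine (hNl a b c d (not_le.1 hi)).trans ?_
        simp [Matrix.diagonal_apply]
      rw [h1, h2, Matrix.det_one, one_mul, Matrix.det_diagonal, Finset.prod_const,
        Finset.card_univ, card_lower]
    · rintro ⟨a, b⟩ hi ⟨c, d⟩ hj
      rw [hNl a b c d (not_le.1 hi), if_neg]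
      rintro ⟨rfl, rfl⟩; exact hi hj
  rw [Matrix.det_mul, hPd, one_mul] at hdet
  exact hdet

theorem herm_add_smul {r : ℕ} (x v : HermCoord r) (t : ℝ) :
    herm (x + t • v) = herm x + t • herm v := by
  ext i j
  simp only [herm, Matrix.of_apply, Matrix.add_apply, Matrix.smul_apply, Pi.add_apply,
    Pi.smul_apply, smul_eq_mul, Complex.real_smul]
  split_ifs <;> push_cast <;> ring

/-- The derivative of `(T + tE)⁻¹ (S + tG)` at `t = 0`. -/
theorem hasDerivAt_inv_mul_pencil {𝕜 m n : Type*} [NontriviallyNormedField 𝕜] [NormedAlgebra 𝕜 ℂ]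
    [Fintype n] [DecidableEq n] {T E : Matrix n n ℂ} {S G : Matrix n m ℂ} (hT : T.det ≠ 0)
    (k : n) (l : m) :
    HasDerivAt (fun t : 𝕜 => ((T + t • E)⁻¹ * (S + t • G)) k l)
      ((T⁻¹ * (G - E * (T⁻¹ * S))) k l) 0 := by
  have hc : Continuous fun t : 𝕜 => T + t • E := by fun_prop
  have hdet : ∀ᶠ t : 𝕜 in nhds 0, (T + t • E).det ≠ 0 :=
    hc.matrix_det.continuousAt.eventually_ne (by simpa using hT)
  have hinv : ContinuousAt (fun t : 𝕜 => (T + t • E)⁻¹) 0 := by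
    refine ContinuousAt.comp (g := fun M : Matrix n n ℂ => M⁻¹) ?_ hc.continuousAt
    refine continuousAt_matrix_inv _ ?_
    simp only [zero_smul, add_zero, Ring.inverse_eq_inv']
    exact continuousAt_inv₀ hT
  have hg : ContinuousAt (fun t : 𝕜 => ((T + t • E)⁻¹ * (G - E * (T⁻¹ * S))) k l) 0 := by
    have h1 : Continuous fun M : Matrix n n ℂ => (M * (G - E * (T⁻¹ * S))) k l :=
      (continuous_id.matrix_mul continuous_const).matrix_elem k l
    exact h1.continuousAt.comp hinv
  rw [hasDerivAt_iff_tendsto_slope_zero]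
  have h0 : Filter.Tendsto (fun t : 𝕜 => ((T + t • E)⁻¹ * (G - E * (T⁻¹ * S))) k l)
      (nhdsWithin 0 {0}ᶜ) (nhds ((T⁻¹ * (G - E * (T⁻¹ * S))) k l)) := by
    have := hg.tendsto
    simp only [zero_smul, add_zero] at this
    exact this.mono_left nhdsWithin_le_nhds
  refine h0.congr' ?_
  filter_upwards [nhdsWithin_le_nhds hdet, self_mem_nhdsWithin] with t ht ht0
  -- The difference quotient is computed exactly, so only continuity of the inverse is needed.
  have e : (T + t • E)⁻¹ * (S + t • G) - T⁻¹ * S =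
      t • ((T + t • E)⁻¹ * (G - E * (T⁻¹ * S))) := by
    have hS : T * (T⁻¹ * S) = S := Matrix.mul_nonsing_inv_cancel_left _ _ hT.isUnit
    have h1 : (T + t • E)⁻¹ * ((T + t • E) * (T⁻¹ * S)) = T⁻¹ * S :=
      Matrix.nonsing_inv_mul_cancel_left _ _ ht.isUnit
    calc _ = (T + t • E)⁻¹ * (S + t • G) -
          (T + t • E)⁻¹ * ((T + t • E) * (T⁻¹ * S)) := by rw [h1]
      _ = _ := by
        rw [← Matrix.mul_sub, Matrix.add_mul, hS, ← Matrix.mul_smul, smul_sub, Matrix.smul_mul]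
        congr 1
        abel
  have e' := congrFun (congrFun e k) l
  simp only [Matrix.sub_apply, Matrix.smul_apply] at e'
  simp only [zero_add, zero_smul, add_zero]
  rw [e', inv_smul_smul₀ ht0]

/-- The pullback of `du` to the cell: with `t = (t', t'') = (1, U) g⁻¹`, one has
`du = (det t')^(-2r) (det g)^(-r) (-2i)^(r(r-1)/2) dU`. -/
theorem pullbackCoeff_cell {r : ℕ} (z : Vars r) (x : HermCoord r)
    (hx : ((cellHom z x).toCols₁).det ≠ 0) :
    pullbackCoeff (cell z) x = (((cellHom z x).toCols₁).det ^ (2 * r))⁻¹ *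
      ((gMatrix z).det ^ r)⁻¹ * (-2 * Complex.I) ^ (r * (r - 1) / 2) := by
  set T := (cellHom z x).toCols₁ with hT
  set S := (cellHom z x).toCols₂ with hS
  set Q := (gMatrix z)⁻¹ with hQ
  set C := Q.toBlocks₂₁
  set D := Q.toBlocks₂₂
  set X := D - C * (T⁻¹ * S) with hX
  have hcell : ∀ y, cellHom z y = Matrix.fromCols (Q.toBlocks₁₁ + herm y * C)
      (Q.toBlocks₁₂ + herm y * D) := by
    intro y
    rw [cellHom, ← hQ, ← Matrix.fromBlocks_toBlocks Q, Matrix.fromCols_mul_fromBlocks]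
    simp [C, D]
  have hT' : T = Q.toBlocks₁₁ + herm x * C := by rw [hT, hcell]; simp
  have hS' : S = Q.toBlocks₁₂ + herm x * D := by rw [hS, hcell]; simp
  have hder : ∀ (v : HermCoord r) k l, lineDeriv ℝ (fun y => cell z y k l) x v =
      (T⁻¹ * (herm v * X)) k l := by
    intro v k l
    have h := hasDerivAt_inv_mul_pencil (𝕜 := ℝ) (E := herm v * C) (S := S) (G := herm v * D) hx k l
    have e : herm v * D - herm v * C * (T⁻¹ * S) = herm v * X := by
      rw [hX, Matrix.mul_sub, Matrix.mul_assoc]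
    rw [e] at h
    rw [lineDeriv, ← h.deriv]
    congr 1
    funext t
    rw [cell, hcell, Matrix.toCols₁_fromCols, Matrix.toCols₂_fromCols, herm_add_smul, hT', hS',
      Matrix.add_mul, Matrix.add_mul, Matrix.smul_mul, Matrix.smul_mul, add_assoc, add_assoc]
  -- The differential is V ↦ T⁻¹ V X, a Kronecker product after the linear map `herm`. Its
  -- determinant is (det T)^(-r) (det X)^r.
  have hmat : (Matrix.of fun kl ij : Fin r × Fin r =>
      lineDeriv ℝ (fun y => cell z y kl.1 kl.2) x (Pi.single ij.1 (Pi.single ij.2 1))) =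
      Matrix.kroneckerMap (· * ·) T⁻¹ X.transpose * hermMatrix r := by
    ext ⟨k, l⟩ ⟨i, j⟩
    simp only [Matrix.of_apply, hder, Matrix.mul_apply, Fintype.sum_prod_type,
      Matrix.kroneckerMap_apply, hermMatrix, Matrix.transpose_apply, Finset.mul_sum]
    refine Finset.sum_congr rfl fun a _ => Finset.sum_congr rfl fun b _ => ?_
    ring
  -- `X` is the Schur complement of `T` in the product of a unipotent matrix with g⁻¹.
  have hXdet : T.det * X.det = (gMatrix z).det⁻¹ := by
    have h1 : Matrix.fromBlocks 1 (herm x) 0 1 * Q = Matrix.fromBlocks T S C D := by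
      rw [← Matrix.fromBlocks_toBlocks Q, Matrix.fromBlocks_multiply, hT', hS']
      simp [C, D]
    have h2 := congrArg Matrix.det h1
    have := Matrix.invertibleOfIsUnitDet T hx.isUnit
    rw [Matrix.det_mul, Matrix.det_fromBlocks_zero₂₁, Matrix.det_fromBlocks₁₁,
      Matrix.invOf_eq_nonsing_inv, hQ, Matrix.det_nonsing_inv, Ring.inverse_eq_inv'] at h2
    rw [hX, ← Matrix.mul_assoc, ← h2]
    simp
  rw [pullbackCoeff, hmat, Matrix.det_mul, det_hermMatrix, Matrix.det_kronecker,
    Matrix.det_transpose, Matrix.det_nonsing_inv, Ring.inverse_eq_inv', Fintype.card_fin]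
  have : X.det = T.det⁻¹ * (gMatrix z).det⁻¹ := by
    rw [← hXdet, inv_mul_cancel_left₀ hx]
  rw [this]
  congr 1
  rw [mul_pow, two_mul, pow_add, inv_pow, inv_pow, mul_inv]
  ring

/-! ### Powers of complex numbers with positive real part -/

theorem ne_zero_of_re_pos {a : ℂ} (ha : 0 < a.re) : a ≠ 0 := by
  rintro rfl; simp at ha

/-- Both arguments lie in (-π/2, π/2), so their sum stays on the principal branch. -/
theorem mul_cpow_of_re_pos {a b : ℂ} (ha : 0 < a.re) (hb : 0 < b.re) (s : ℂ) :
    (a * b) ^ s = a ^ s * b ^ s := by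
  have a0 := ne_zero_of_re_pos ha
  have b0 := ne_zero_of_re_pos hb
  have h1 := abs_lt.1 (Complex.abs_arg_lt_pi_div_two_iff.2 (Or.inl ha))
  have h2 := abs_lt.1 (Complex.abs_arg_lt_pi_div_two_iff.2 (Or.inl hb))
  rw [Complex.cpow_def_of_ne_zero (mul_ne_zero a0 b0), Complex.cpow_def_of_ne_zero a0,
    Complex.cpow_def_of_ne_zero b0, ← Complex.exp_add,
    (Complex.log_mul_eq_add_log_iff a0 b0).2 ⟨by linarith [h1.1, h2.1], by linarith [h1.2, h2.2]⟩,
    add_mul]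

theorem mul_mem_slitPlane_of_re_pos {a b : ℂ} (ha : 0 < a.re) (hb : 0 < b.re) :
    a * b ∈ Complex.slitPlane := by
  have a0 := ne_zero_of_re_pos ha
  have b0 := ne_zero_of_re_pos hb
  have h1 := abs_lt.1 (Complex.abs_arg_lt_pi_div_two_iff.2 (Or.inl ha))
  have h2 := abs_lt.1 (Complex.abs_arg_lt_pi_div_two_iff.2 (Or.inl hb))
  have h : a.arg + b.arg ∈ Set.Ioc (-Real.pi) Real.pi :=
    ⟨by linarith [h1.1, h2.1], by linarith [h1.2, h2.2]⟩
  rw [Complex.mem_slitPlane_iff_arg, (Complex.arg_mul_eq_add_arg_iff a0 b0).2 h]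
  exact ⟨by linarith [h1.2, h2.2], mul_ne_zero a0 b0⟩

theorem inv_re_pos {a : ℂ} (ha : 0 < a.re) : 0 < (a⁻¹).re := by
  rw [Complex.inv_re]
  exact div_pos ha (Complex.normSq_pos.2 (ne_zero_of_re_pos ha))

theorem inv_cpow_of_re_pos {a : ℂ} (ha : 0 < a.re) (s : ℂ) : a⁻¹ ^ s = (a ^ s)⁻¹ := by
  refine Complex.inv_cpow _ _ fun h => ?_
  have := Complex.abs_arg_lt_pi_div_two_iff.2 (Or.inl ha)
  rw [h, abs_of_pos Real.pi_pos] at this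
  linarith [Real.pi_pos]

theorem ofReal_mul_cpow {e : ℝ} (he : 0 < e) {w : ℂ} (hw : w ≠ 0) (s : ℂ) :
    (e * w) ^ s = (e : ℂ) ^ s * w ^ s := by
  have e0 : (e : ℂ) ≠ 0 := by exact_mod_cast he.ne'
  rw [Complex.cpow_def_of_ne_zero (mul_ne_zero e0 hw), Complex.cpow_def_of_ne_zero e0,
    Complex.cpow_def_of_ne_zero hw, ← Complex.exp_add, Complex.log_ofReal_mul he hw,
    Complex.ofReal_log he.le, add_mul]

/-! ### Minors -/

/-- The minor `det (z⁽ⁱ⁾, z⁽ʲ⁾)`. -/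
def minor {r : ℕ} (z : Vars r) (i j : Fin 3) : ℂ :=
  (Matrix.fromCols (block z i) (block z j)).det

/-- The minor `det (z⁽ⁱ⁾, z⁽ʲ⁾)`, divided by its value at the normal form. -/
def normMinor {r : ℕ} (i j : Fin 3) (z : Vars r) : ℂ := minor z i j / minor (normalForm r) i j

theorem det_swap_blocks (r : ℕ) :
    (Matrix.fromBlocks 0 1 1 0 : Matrix (Fin r ⊕ Fin r) (Fin r ⊕ Fin r) ℂ).det =
      (-1) ^ r := by
  have h : (Matrix.fromBlocks 0 1 1 0 : Matrix (Fin r ⊕ Fin r) (Fin r ⊕ Fin r) ℂ) *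
      Matrix.fromBlocks 1 0 1 1 = Matrix.fromBlocks 1 1 1 0 := by
    simp [Matrix.fromBlocks_multiply]
  have h' := congrArg Matrix.det h
  rw [Matrix.det_mul, Matrix.det_fromBlocks_zero₁₂, Matrix.det_fromBlocks_one₁₁] at h'
  simpa [Matrix.det_neg] using h'

theorem minor_swap {r : ℕ} (z : Vars r) (i j : Fin 3) :
    minor z j i = (-1) ^ r * minor z i j := by
  have : Matrix.fromCols (block z j) (block z i) =
      Matrix.fromCols (block z i) (block z j) * Matrix.fromBlocks 0 1 1 0 := by
    simp [Matrix.fromCols_mul_fromBlocks]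
  rw [minor, this, Matrix.det_mul, det_swap_blocks, mul_comm]
  rfl

/-- The sign (-1)^r of an interchange of blocks cancels in the quotient, so a normalized minor
depends on the unordered pair only. -/
theorem normMinor_comm {r : ℕ} (i j : Fin 3) : normMinor (r := r) i j = normMinor j i := by
  funext z
  rw [normMinor, normMinor, minor_swap z i j, minor_swap (normalForm r) i j,
    mul_div_mul_left _ _ (pow_ne_zero _ (neg_ne_zero.2 one_ne_zero))]

theorem block_normalForm_zero (r : ℕ) : block (normalForm r) 0 = Matrix.fromRows 1 0 := rfl

theorem block_normalForm_one (r : ℕ) : block (normalForm r) 1 = Matrix.fromRows 0 1 := rfl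

theorem block_normalForm_two (r : ℕ) : block (normalForm r) 2 = Matrix.fromRows 1 (-1) := rfl

theorem minor_normalForm_zero_one (r : ℕ) : minor (normalForm r) 0 1 = 1 := by
  rw [minor, block_normalForm_zero, block_normalForm_one,
    Matrix.fromCols_fromRows_eq_fromBlocks, Matrix.fromBlocks_one, Matrix.det_one]

theorem minor_normalForm_zero_two (r : ℕ) : minor (normalForm r) 0 2 = (-1) ^ r := by
  rw [minor, block_normalForm_zero, block_normalForm_two,
    Matrix.fromCols_fromRows_eq_fromBlocks, Matrix.det_fromBlocks_zero₂₁]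
  simp [Matrix.det_neg]

theorem minor_normalForm_two_one (r : ℕ) : minor (normalForm r) 2 1 = 1 := by
  rw [minor, block_normalForm_one, block_normalForm_two,
    Matrix.fromCols_fromRows_eq_fromBlocks, Matrix.det_fromBlocks_zero₁₂]
  simp

theorem neg_one_pow_mul_self (r : ℕ) : ((-1 : ℂ) ^ r) * (-1) ^ r = 1 := by
  rw [← mul_pow]; simp

/-- The origin of σ_{ij}: the quotient of minors det Y, taken at the normal form. The extra (-1)^r
is absorbed by b(-r-α⁽ⁱ⁾) = (-1)^r b(α⁽ⁱ⁾+1). -/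
theorem minor_normalForm_ratio (r : ℕ) {i j k : Fin 3} (hij : i ≠ j) (hik : i ≠ k) (hjk : j ≠ k) :
    minor (normalForm r) i k = (-1) ^ r * rootSign r i j * minor (normalForm r) j k ∧
      minor (normalForm r) j k ≠ 0 := by
  have h := neg_one_pow_mul_self r
  have h0 : ((-1 : ℂ) ^ r) ≠ 0 := pow_ne_zero _ (neg_ne_zero.2 one_ne_zero)
  have h01 := minor_normalForm_zero_one r
  have h02 := minor_normalForm_zero_two r
  have h21 := minor_normalForm_two_one r
  have h10 : minor (normalForm r) 1 0 = (-1) ^ r := by rw [minor_swap _ 0 1, h01, mul_one]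
  have h20 : minor (normalForm r) 2 0 = 1 := by rw [minor_swap _ 0 2, h02, h]
  have h12 : minor (normalForm r) 1 2 = (-1) ^ r := by rw [minor_swap _ 2 1, h21, mul_one]
  fin_cases i <;> fin_cases j <;> fin_cases k <;>
    simp [rootSign, h01, h02, h21, h10, h20, h12, h] at hij hik hjk ⊢

theorem minor_normalForm_ne_zero (r : ℕ) {i j : Fin 3} (hij : i ≠ j) :
    minor (normalForm r) i j ≠ 0 := by
  obtain ⟨k, hk⟩ : ∃ k : Fin 3, k ≠ i ∧ k ≠ j := by decide +revert
  exact (minor_normalForm_ratio r hk.1 hk.2 hij).2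

theorem normMinor_normalForm (r : ℕ) {i j : Fin 3} (hij : i ≠ j) :
    normMinor i j (normalForm r) = 1 :=
  div_self (minor_normalForm_ne_zero r hij)

theorem continuous_block (r : ℕ) (k : Fin 3) : Continuous fun z : Vars r => block z k := by
  unfold block; fun_prop

theorem continuous_fromCols (r : ℕ) (i j : Fin 3) :
    Continuous fun z : Vars r => Matrix.fromCols (block z i) (block z j) := by
  refine continuous_matrix fun a b => ?_
  rcases b with b | b <;> simp only [Matrix.fromCols_apply_inl, Matrix.fromCols_apply_inr] <;>
    exact (continuous_block r _).matrix_elem _ _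

theorem continuous_minor (r : ℕ) (i j : Fin 3) : Continuous fun z : Vars r => minor z i j :=
  (continuous_fromCols r i j).matrix_det

theorem continuous_normMinor (r : ℕ) (i j : Fin 3) :
    Continuous (normMinor i j : Vars r → ℂ) :=
  (continuous_minor r i j).div_const _

/-! ### The matrices `g` and `h` -/

/-- The blocks of `h = diag(1, -v₁ v₂⁻¹, v₁)`, so that `z = g 𝐱 h`. -/
def hBlock {r : ℕ} (z : Vars r) : Fin 3 → Matrix (Fin r) (Fin r) ℂ :=
  ![1, -((vMatrix z).toRows₁ * ((vMatrix z).toRows₂)⁻¹), (vMatrix z).toRows₁]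

theorem fromCols_mul_vMatrix {r : ℕ} (z : Vars r) (h : minor z 0 1 ≠ 0) :
    block z 0 * (vMatrix z).toRows₁ + block z 1 * (vMatrix z).toRows₂ = block z 2 := by
  rw [← Matrix.fromCols_mul_fromRows, Matrix.fromRows_toRows, vMatrix,
    Matrix.mul_nonsing_inv_cancel_left _ _ h.isUnit]

/-- Cramer's rule for blocks: replace z⁽¹⁾ by z⁽³⁾ = z⁽¹⁾v₁ + z⁽²⁾v₂ in (z⁽¹⁾, z⁽²⁾). -/
theorem det_toRows₁ {r : ℕ} (z : Vars r) (h : minor z 0 1 ≠ 0) :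
    minor z 0 1 * (vMatrix z).toRows₁.det = minor z 2 1 := by
  have e : Matrix.fromCols (block z 0) (block z 1) *
      Matrix.fromBlocks (vMatrix z).toRows₁ 0 (vMatrix z).toRows₂ 1 =
        Matrix.fromCols (block z 2) (block z 1) := by
    rw [Matrix.fromCols_mul_fromBlocks, fromCols_mul_vMatrix z h]; simp
  have := congrArg Matrix.det e
  rw [Matrix.det_mul, Matrix.det_fromBlocks_zero₁₂, Matrix.det_one, mul_one] at this
  exact this

theorem det_toRows₂ {r : ℕ} (z : Vars r) (h : minor z 0 1 ≠ 0) :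
    minor z 0 1 * (vMatrix z).toRows₂.det = minor z 0 2 := by
  have e : Matrix.fromCols (block z 0) (block z 1) *
      Matrix.fromBlocks 1 (vMatrix z).toRows₁ 0 (vMatrix z).toRows₂ =
        Matrix.fromCols (block z 0) (block z 2) := by
    rw [Matrix.fromCols_mul_fromBlocks, fromCols_mul_vMatrix z h]; simp
  have := congrArg Matrix.det e
  rw [Matrix.det_mul, Matrix.det_fromBlocks_zero₂₁, Matrix.det_one, one_mul] at this
  exact this

theorem block_eq_mul {r : ℕ} (z : Vars r) (h01 : minor z 0 1 ≠ 0) (h02 : minor z 0 2 ≠ 0)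
    (h21 : minor z 2 1 ≠ 0) (k : Fin 3) :
    block z k = gMatrix z * block (normalForm r) k * hBlock z k := by
  have d1 := det_toRows₁ z h01
  have d2 := det_toRows₂ z h01
  have u1 : IsUnit (vMatrix z).toRows₁.det :=
    (right_ne_zero_of_mul (d1 ▸ h21)).isUnit
  have u2 : IsUnit (vMatrix z).toRows₂.det :=
    (right_ne_zero_of_mul (d2 ▸ h02)).isUnit
  have e := fromCols_mul_vMatrix z h01
  set v₁ := (vMatrix z).toRows₁ with hv1
  set v₂ := (vMatrix z).toRows₂ with hv2
  have hg : gMatrix z = Matrix.fromCols (block z 0) (-(block z 1 * (v₂ * v₁⁻¹))) := by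
    rw [gMatrix, Matrix.fromCols_mul_fromBlocks]; simp [← hv1, ← hv2]
  fin_cases k
  · simp only [Fin.zero_eta]
    rw [hg, block_normalForm_zero, Matrix.fromCols_mul_fromRows]
    simp [hBlock]
  · simp only [Fin.mk_one]
    rw [hg, block_normalForm_one, Matrix.fromCols_mul_fromRows]
    have : block z 1 * (v₂ * v₁⁻¹) * (v₁ * v₂⁻¹) = block z 1 := by
      rw [Matrix.mul_assoc, Matrix.mul_assoc, Matrix.nonsing_inv_mul_cancel_left _ _ u1,
        Matrix.mul_nonsing_inv _ u2, Matrix.mul_one]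
    simp [hBlock, ← hv1, ← hv2, this]
  · show block z 2 = gMatrix z * block (normalForm r) 2 * hBlock z 2
    rw [hg, block_normalForm_two, Matrix.fromCols_mul_fromRows]
    have : block z 1 * (v₂ * v₁⁻¹) * v₁ = block z 1 * v₂ := by
      rw [Matrix.mul_assoc, Matrix.mul_assoc, Matrix.nonsing_inv_mul _ u1, Matrix.mul_one]
    simp [hBlock, ← hv1, Matrix.add_mul, this, e]

theorem det_hBlock {r : ℕ} (z : Vars r) (h01 : minor z 0 1 ≠ 0) (k : Fin 3) :
    (hBlock z k).det =
      ![1, normMinor 1 2 z / normMinor 0 2 z, normMinor 1 2 z / normMinor 0 1 z] k := by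
  have d1 := det_toRows₁ z h01
  have d2 := det_toRows₂ z h01
  have e1 : (vMatrix z).toRows₁.det = minor z 2 1 / minor z 0 1 := by
    rw [← d1, mul_div_cancel_left₀ _ h01]
  have e2 : (vMatrix z).toRows₂.det = minor z 0 2 / minor z 0 1 := by
    rw [← d2, mul_div_cancel_left₀ _ h01]
  rw [normMinor_comm 1 2]
  have h := neg_one_pow_mul_self r
  fin_cases k
  · simp [hBlock]
  · simp [hBlock, Matrix.det_neg, normMinor, minor_normalForm_two_one, minor_normalForm_zero_two,
      Matrix.det_nonsing_inv, e1, e2]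
    field_simp
  · simp [hBlock, normMinor, minor_normalForm_two_one, minor_normalForm_zero_one, e1]

theorem det_gMatrix {r : ℕ} (z : Vars r) (h01 : minor z 0 1 ≠ 0) :
    (gMatrix z).det = normMinor 0 1 z * normMinor 0 2 z / normMinor 1 2 z := by
  have d1 := det_toRows₁ z h01
  have d2 := det_toRows₂ z h01
  have e1 : (vMatrix z).toRows₁.det = minor z 2 1 / minor z 0 1 := by
    rw [← d1, mul_div_cancel_left₀ _ h01]
  have e2 : (vMatrix z).toRows₂.det = minor z 0 2 / minor z 0 1 := by
    rw [← d2, mul_div_cancel_left₀ _ h01]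
  have h := neg_one_pow_mul_self r
  have h0 : ((-1 : ℂ) ^ r) ≠ 0 := pow_ne_zero _ (neg_ne_zero.2 one_ne_zero)
  have hi : ((-1 : ℂ) ^ r)⁻¹ = (-1) ^ r := inv_eq_of_mul_eq_one_left h
  rw [normMinor_comm 1 2, gMatrix, Matrix.det_mul, Matrix.det_fromBlocks_zero₂₁, Matrix.det_one,
    one_mul, Matrix.det_neg, Matrix.det_mul, Matrix.det_nonsing_inv, Ring.inverse_eq_inv', e1, e2,
    normMinor, normMinor, normMinor, minor_normalForm_two_one, minor_normalForm_zero_two,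
    minor_normalForm_zero_one, Fintype.card_fin, ← minor, div_eq_mul_inv _ ((-1 : ℂ) ^ r), hi]
  field_simp

theorem vMatrix_normalForm (r : ℕ) : vMatrix (normalForm r) = Matrix.fromRows 1 (-1) := by
  rw [vMatrix, block_normalForm_zero, block_normalForm_one, block_normalForm_two,
    Matrix.fromCols_fromRows_eq_fromBlocks, Matrix.fromBlocks_one, inv_one, Matrix.one_mul]

theorem gMatrix_normalForm (r : ℕ) : gMatrix (normalForm r) = 1 := by
  rw [gMatrix, vMatrix_normalForm, block_normalForm_zero, block_normalForm_one,
    Matrix.fromCols_fromRows_eq_fromBlocks, Matrix.fromBlocks_one]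
  simp

/-! ### The neighbourhood of the normal form -/

/-- The diagonal entries lie in (0,1), and the 2 × 2 principal minors give |U_{ij}|² < U_{ii}U_{jj}.
This puts the domain in a compact cube. -/
theorem norm_herm_apply_lt_one {r : ℕ} {x : HermCoord r} (hx : x ∈ betaDomain r) (i j : Fin r) :
    ‖herm x i j‖ < 1 := by
  have hd : ∀ k, 0 < (herm x k k).re ∧ (herm x k k).re < 1 ∧ (herm x k k).im = 0 := by
    intro k
    have h1 := Complex.lt_def.1 (hx.1.diag_pos (i := k))
    have h2 := Complex.lt_def.1 (hx.2.diag_pos (i := k))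
    simp only [Matrix.sub_apply, Matrix.one_apply_eq, Complex.zero_re, Complex.sub_re,
      Complex.one_re, Complex.zero_im] at h1 h2
    exact ⟨h1.1, by linarith [h2.1], h1.2.symm⟩
  by_cases hij : i = j
  · subst hij
    obtain ⟨h1, h2, h3⟩ := hd i
    rw [show herm x i i = ((herm x i i).re : ℂ) from Complex.ext rfl (by simp [h3]),
      Complex.norm_real, Real.norm_of_nonneg h1.le]
    exact h2
  · have hinj : Function.Injective ![i, j] := by
      intro a b hab
      fin_cases a <;> fin_cases b <;> simp_all
    have hdet := (hx.1.submatrix (e := ![i, j]) hinj).det_pos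
    rw [Matrix.det_fin_two] at hdet
    simp only [Matrix.submatrix_apply, Matrix.cons_val_zero, Matrix.cons_val_one] at hdet
    rw [← (herm_isHermitian x).apply j i] at hdet
    have := (Complex.lt_def.1 hdet).1
    obtain ⟨h1, h2, h3⟩ := hd i
    obtain ⟨h4, h5, h6⟩ := hd j
    rw [Complex.sub_re, Complex.mul_re, h3, h6, show star (herm x i j) =
      (starRingEnd ℂ) (herm x i j) from rfl, Complex.mul_conj, Complex.ofReal_re,
      Complex.normSq_eq_norm_sq, Complex.zero_re] at this
    nlinarith [norm_nonneg (herm x i j)]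

theorem abs_coord_lt_one {r : ℕ} {x : HermCoord r} (hx : x ∈ betaDomain r) (i j : Fin r) :
    |x i j| < 1 := by
  rcases lt_trichotomy i j with h | h | h
  · have e : x i j = (herm x i j).re := by simp [herm, h.ne, h]
    rw [e]
    exact (Complex.abs_re_le_norm _).trans_lt (norm_herm_apply_lt_one hx i j)
  · have e : x i j = (herm x i j).re := by simp [herm, h]
    rw [e]
    exact (Complex.abs_re_le_norm _).trans_lt (norm_herm_apply_lt_one hx i j)
  · have e : x i j = (herm x j i).im := by simp [herm, h.ne, h]
    rw [e]
    exact (Complex.abs_im_le_norm _).trans_lt (norm_herm_apply_lt_one hx j i)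

/-- The conditions on `z` that hold near the normal form and under which all the quantities
in the integral stay in the domain of the principal branches. -/
structure NearNormalForm {r : ℕ} (z : Vars r) : Prop where
  pos_zero_one : 0 < (normMinor 0 1 z).re
  pos_zero_two : 0 < (normMinor 0 2 z).re
  pos_one_two : 0 < (normMinor 1 2 z).re
  pos_div_zero_two : 0 < (normMinor 1 2 z / normMinor 0 2 z).re
  pos_div_zero_one : 0 < (normMinor 1 2 z / normMinor 0 1 z).re
  pos_chart : ∀ x ∈ betaDomain r, 0 < ((cellHom z x).toCols₁).det.re

theorem continuousAt_inv_of_det_ne_zero {X n : Type*} [TopologicalSpace X] [Fintype n]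
    [DecidableEq n] {M : X → Matrix n n ℂ} {x : X} (hM : ContinuousAt M x) (hx : (M x).det ≠ 0) :
    ContinuousAt (fun y => (M y)⁻¹) x := by
  refine ContinuousAt.comp (g := fun A : Matrix n n ℂ => A⁻¹) ?_ hM
  refine continuousAt_matrix_inv _ ?_
  rw [Ring.inverse_eq_inv']
  exact continuousAt_inv₀ hx

theorem continuousAt_matrix_mul {X l m n : Type*} [TopologicalSpace X] [Fintype m]
    {M : X → Matrix l m ℂ} {N : X → Matrix m n ℂ} {x : X} (hM : ContinuousAt M x)
    (hN : ContinuousAt N x) : ContinuousAt (fun y => M y * N y) x := by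
  have h : Continuous fun p : Matrix l m ℂ × Matrix m n ℂ => p.1 * p.2 :=
    continuous_fst.matrix_mul continuous_snd
  exact h.continuousAt.comp (hM.prodMk hN)

theorem continuousAt_gMatrix (r : ℕ) : ContinuousAt (gMatrix : Vars r → _) (normalForm r) := by
  have hc := (continuous_fromCols r 0 1).continuousAt (x := normalForm r)
  have hv : ContinuousAt (vMatrix : Vars r → _) (normalForm r) :=
    continuousAt_matrix_mul (continuousAt_inv_of_det_ne_zero hc
      (minor_normalForm_ne_zero r (by decide))) (continuous_block r 2).continuousAt
  have h1 : Continuous fun M : Matrix (Fin r ⊕ Fin r) (Fin r) ℂ => M.toRows₁ :=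
    continuous_id.matrix_submatrix Sum.inl id
  have h2 : Continuous fun M : Matrix (Fin r ⊕ Fin r) (Fin r) ℂ => M.toRows₂ :=
    continuous_id.matrix_submatrix Sum.inr id
  refine continuousAt_matrix_mul hc ?_
  have h3 : ContinuousAt (fun z : Vars r =>
      -((vMatrix z).toRows₂ * ((vMatrix z).toRows₁)⁻¹)) (normalForm r) := by
    refine (continuousAt_matrix_mul (h2.continuousAt.comp hv)
      (continuousAt_inv_of_det_ne_zero (h1.continuousAt.comp hv) ?_)).neg
    simp [vMatrix_normalForm]
  have h4 : Continuous fun M : Matrix (Fin r) (Fin r) ℂ =>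
      (Matrix.fromBlocks 1 0 0 M : Matrix (Fin r ⊕ Fin r) (Fin r ⊕ Fin r) ℂ) :=
    continuous_const.matrix_fromBlocks continuous_const continuous_const continuous_id
  exact h4.continuousAt.comp h3

/-- Every quantity involved equals 1 at the normal form. The chart condition must hold for all
points of the cell at once, which follows from compactness of the cube [-1,1]^(r×r). None of the
conditions involves α. -/
theorem eventually_nearNormalForm (r : ℕ) :
    ∀ᶠ z in nhds (normalForm r), NearNormalForm z := by
  have n01 := normMinor_normalForm r (i := 0) (j := 1) (by decide)
  have n02 := normMinor_normalForm r (i := 0) (j := 2) (by decide)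
  have n12 := normMinor_normalForm r (i := 1) (j := 2) (by decide)
  have pos : ∀ {f : Vars r → ℂ}, ContinuousAt f (normalForm r) → f (normalForm r) = 1 →
      ∀ᶠ z in nhds (normalForm r), 0 < (f z).re := by
    intro f hf h
    refine (Complex.continuous_re.continuousAt.comp hf).eventually (lt_mem_nhds ?_)
    simp [h]
  have c := fun i j => (continuous_normMinor r i j).continuousAt (x := normalForm r)
  have hK : IsCompact (Set.univ.pi fun _ : Fin r => Set.univ.pi fun _ : Fin r =>
      Set.Icc (-1 : ℝ) 1) := isCompact_univ_pi fun _ => isCompact_univ_pi fun _ => isCompact_Icc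
  -- At the normal form t' = 1 for every x in the cube, positive definite or not.
  have chart := hK.eventually_forall_of_forall_eventually (x₀ := normalForm r)
    (P := fun z x => 0 < ((cellHom z x).toCols₁).det.re) <| by
      intro x _
      have h1 : ContinuousAt (fun p : Vars r × HermCoord r => cellHom p.1 p.2)
          (normalForm r, x) := by
        have h0 : ContinuousAt (fun p : Vars r × HermCoord r => gMatrix p.1) (normalForm r, x) :=
          ContinuousAt.comp (g := gMatrix) (f := Prod.fst) (x := (normalForm r, x))
            (continuousAt_gMatrix r) continuousAt_fst
        refine continuousAt_matrix_mul ?_ (continuousAt_inv_of_det_ne_zero h0 ?_)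
        · refine Continuous.continuousAt (continuous_matrix fun a b => ?_)
          rcases b with b | b
          · simp only [Matrix.fromCols_apply_inl]; exact continuous_const
          · simp only [Matrix.fromCols_apply_inr]
            exact ((continuous_herm r).comp continuous_snd).matrix_elem a b
        · simp [gMatrix_normalForm]
      have h2 : Continuous fun M : Matrix (Fin r) (Fin r ⊕ Fin r) ℂ => M.toCols₁.det.re :=
        Complex.continuous_re.comp (continuous_id.matrix_submatrix id Sum.inl).matrix_det
      refine (h2.continuousAt.comp h1).eventually (lt_mem_nhds ?_)
      simp [cellHom, gMatrix_normalForm]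
  filter_upwards [pos (c 0 1) n01, pos (c 0 2) n02, pos (c 1 2) n12,
    pos ((c 1 2).div (c 0 2) (by rw [n02]; exact one_ne_zero)) (by simp [n02, n12]),
    pos ((c 1 2).div (c 0 1) (by rw [n01]; exact one_ne_zero)) (by simp [n01, n12]), chart]
    with z h1 h2 h3 h4 h5 h6
  refine ⟨h1, h2, h3, h4, h5, fun x hx => h6 x ?_⟩
  exact fun i _ j _ => ⟨(abs_lt.1 (abs_coord_lt_one hx i j)).1.le,
    (abs_lt.1 (abs_coord_lt_one hx i j)).2.le⟩

namespace NearNormalForm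

variable {r : ℕ} {z : Vars r}

theorem minor_ne_zero (hz : NearNormalForm z) {i j : Fin 3} (hij : i ≠ j) : minor z i j ≠ 0 := by
  suffices h : normMinor i j z ≠ 0 from fun h' => h (by rw [normMinor, h', zero_div])
  have h01 := ne_zero_of_re_pos hz.pos_zero_one
  have h02 := ne_zero_of_re_pos hz.pos_zero_two
  have h12 := ne_zero_of_re_pos hz.pos_one_two
  fin_cases i <;> fin_cases j
  · exact absurd rfl hij
  · exact h01
  · exact h02
  · rw [normMinor_comm]; exact h01
  · exact absurd rfl hij
  · exact h12
  · rw [normMinor_comm]; exact h02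
  · rw [normMinor_comm]; exact h12
  · exact absurd rfl hij

theorem mem_genericVars (hz : NearNormalForm z) : z ∈ genericVars r :=
  fun _ _ hij => hz.minor_ne_zero hij

theorem det_gMatrix_ne_zero (hz : NearNormalForm z) : (gMatrix z).det ≠ 0 := by
  rw [det_gMatrix z (hz.minor_ne_zero (by decide))]
  exact div_ne_zero (mul_ne_zero (ne_zero_of_re_pos hz.pos_zero_one)
    (ne_zero_of_re_pos hz.pos_zero_two)) (ne_zero_of_re_pos hz.pos_one_two)

theorem re_det_hBlock_pos (hz : NearNormalForm z) (k : Fin 3) : 0 < (hBlock z k).det.re := by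
  rw [det_hBlock z (hz.minor_ne_zero (by decide))]
  fin_cases k
  · simp
  · exact hz.pos_div_zero_two
  · exact hz.pos_div_zero_one

end NearNormalForm

/-! ### The integral over `C(z)` as a multiple of the beta integral -/

/-- The determinants of `(1, U) 𝐱⁽ᵏ⁾`. -/
def hermFactor {r : ℕ} (x : HermCoord r) : Fin 3 → ℝ :=
  ![1, (herm x).det.re, (1 - herm x).det.re]

theorem hermFactor_pos {r : ℕ} {x : HermCoord r} (hx : x ∈ betaDomain r) (k : Fin 3) :
    0 < hermFactor x k := by
  fin_cases k
  · exact one_pos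
  · exact (posDef_det_eq hx.1).1
  · exact (posDef_det_eq hx.2).1

theorem det_hermFactor {r : ℕ} {x : HermCoord r} (hx : x ∈ betaDomain r) (k : Fin 3) :
    (Matrix.fromCols (1 : Matrix (Fin r) (Fin r) ℂ) (herm x) * block (normalForm r) k).det = (hermFactor x k : ℂ) := by
  fin_cases k
  · simp [block_normalForm_zero, Matrix.fromCols_mul_fromRows, hermFactor]
  · simpa [block_normalForm_one, Matrix.fromCols_mul_fromRows, hermFactor] using
      (posDef_det_eq hx.1).2
  · have : Matrix.fromCols (1 : Matrix (Fin r) (Fin r) ℂ) (herm x) * block (normalForm r) 2 = 1 - herm x := by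
      rw [block_normalForm_two, Matrix.fromCols_mul_fromRows]; simp [sub_eq_add_neg]
    show (Matrix.fromCols (1 : Matrix (Fin r) (Fin r) ℂ) (herm x) * block (normalForm r) 2).det = _
    rw [this]
    exact (posDef_det_eq hx.2).2

/-- (1, u) = (t')⁻¹ t with t g = (1, U), while z⁽ᵏ⁾ = g 𝐱⁽ᵏ⁾ h⁽ᵏ⁾, so g cancels. -/
theorem det_incidence_cell {r : ℕ} {z : Vars r} (hz : NearNormalForm z) {x : HermCoord r}
    (hx : x ∈ betaDomain r) (k : Fin 3) :
    (incidence (cell z x) z k).det = (hermFactor x k : ℂ) *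
      (((cellHom z x).toCols₁).det⁻¹ * (hBlock z k).det) := by
  have hT := ne_zero_of_re_pos (hz.pos_chart x hx)
  have e1 : Matrix.fromCols (1 : Matrix (Fin r) (Fin r) ℂ) (cell z x) = ((cellHom z x).toCols₁)⁻¹ * cellHom z x := by
    conv_rhs => rw [← Matrix.fromCols_toCols (cellHom z x), Matrix.toCols₁_fromCols,
      Matrix.mul_fromCols, Matrix.nonsing_inv_mul _ hT.isUnit]
    rfl
  have e2 : cellHom z x * block z k =
      Matrix.fromCols (1 : Matrix (Fin r) (Fin r) ℂ) (herm x) * block (normalForm r) k * hBlock z k := by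
    rw [block_eq_mul z (hz.minor_ne_zero (by decide)) (hz.minor_ne_zero (by decide))
      (hz.minor_ne_zero (by decide)) k, cellHom, Matrix.mul_assoc, Matrix.mul_assoc,
      Matrix.nonsing_inv_mul_cancel_left _ _ hz.det_gMatrix_ne_zero.isUnit, Matrix.mul_assoc]
  rw [incidence, e1, Matrix.mul_assoc, e2, Matrix.det_mul, Matrix.det_mul,
    Matrix.det_nonsing_inv, Ring.inverse_eq_inv', det_hermFactor hx]
  ring

theorem det_incidence_mem_slitPlane {r : ℕ} {z : Vars r} (hz : NearNormalForm z)
    {x : HermCoord r} (hx : x ∈ betaDomain r) (k : Fin 3) :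
    (incidence (cell z x) z k).det ∈ Complex.slitPlane := by
  rw [det_incidence_cell hz hx, ← mul_assoc]
  refine mul_mem_slitPlane_of_re_pos ?_ (hz.re_det_hBlock_pos k)
  rw [Complex.re_ofReal_mul]
  exact mul_pos (hermFactor_pos hx k) (inv_re_pos (hz.pos_chart x hx))

theorem prod_hermFactor_cpow {r : ℕ} {x : HermCoord r} (hx : x ∈ betaDomain r) (α : Fin 3 → ℂ) :
    ∏ k, (hermFactor x k : ℂ) ^ α k = betaIntegrand r (α 1 + r) (α 2 + r) x := by
  rw [Fin.prod_univ_three, betaIntegrand, (posDef_det_eq hx.1).2, (posDef_det_eq hx.2).2]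
  simp [hermFactor]

/-- The dependence of the Radon hypergeometric function on `z`. -/
def minorPower {r : ℕ} (α : Fin 3 → ℂ) (z : Vars r) : ℂ :=
  normMinor 0 1 z ^ (-(r : ℂ) - α 2) * normMinor 0 2 z ^ (-(r : ℂ) - α 1) *
    normMinor 1 2 z ^ (-(r : ℂ) - α 0)

theorem div_cpow_of_re_pos {a b : ℂ} (ha : 0 < a.re) (hb : 0 < b.re) (s : ℂ) :
    (a / b) ^ s = a ^ s / b ^ s := by
  rw [div_eq_mul_inv, mul_cpow_of_re_pos ha (inv_re_pos hb), inv_cpow_of_re_pos hb,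
    div_eq_mul_inv]

/-- The minor (2,3) appears with exponent r + α⁽²⁾ + α⁽³⁾. The condition on the sum turns this into
-r - α⁽¹⁾, which makes the formula symmetric in the three blocks. -/
theorem minorPower_eq {r : ℕ} {z : Vars r} (hz : NearNormalForm z) {α : Fin 3 → ℂ}
    (hα : ∑ k, α k = -(2 * r : ℂ)) :
    ((gMatrix z).det ^ r)⁻¹ * ∏ k, (hBlock z k).det ^ α k = minorPower α z := by
  have p01 := ne_zero_of_re_pos hz.pos_zero_one
  have p02 := ne_zero_of_re_pos hz.pos_zero_two
  have p12 := ne_zero_of_re_pos hz.pos_one_two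
  rw [Fin.sum_univ_three] at hα
  rw [Fin.prod_univ_three, det_hBlock z (hz.minor_ne_zero (by decide)),
    det_hBlock z (hz.minor_ne_zero (by decide)), det_hBlock z (hz.minor_ne_zero (by decide)),
    det_gMatrix z (hz.minor_ne_zero (by decide))]
  simp only [Matrix.cons_val_zero, Matrix.cons_val_one, Matrix.cons_val, Complex.one_cpow, one_mul]
  rw [div_cpow_of_re_pos hz.pos_one_two hz.pos_zero_two,
    div_cpow_of_re_pos hz.pos_one_two hz.pos_zero_one, minorPower,
    show -(r : ℂ) - α 0 = r + α 1 + α 2 by linear_combination -hα]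
  rw [Complex.cpow_sub _ _ p01, Complex.cpow_sub _ _ p02, Complex.cpow_add _ _ p12,
    Complex.cpow_add _ _ p12, Complex.cpow_neg, Complex.cpow_neg, Complex.cpow_natCast,
    Complex.cpow_natCast, Complex.cpow_natCast, div_pow, mul_pow, inv_div]
  simp only [div_eq_mul_inv, mul_inv]
  ring

/-- The integrand on the cell `C(z)` is a multiple of the integrand of the beta integral. -/
theorem radonIntegrand_cell {r : ℕ} {z : Vars r} (hz : NearNormalForm z) {α : Fin 3 → ℂ}
    (hα : ∑ k, α k = -(2 * r : ℂ)) {x : HermCoord r} (hx : x ∈ betaDomain r) :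
    radonIntegrand (cell z) z α x = minorPower α z * (-2 * Complex.I) ^ (r * (r - 1) / 2) *
      betaIntegrand r (α 1 + r) (α 2 + r) x := by
  have hTp := hz.pos_chart x hx
  have hT := ne_zero_of_re_pos hTp
  set T := ((cellHom z x).toCols₁).det
  have hk : ∀ k, (incidence (cell z x) z k).det ^ α k = (T ^ α k)⁻¹ *
      ((hermFactor x k : ℂ) ^ α k * (hBlock z k).det ^ α k) := by
    intro k
    have hh := hz.re_det_hBlock_pos k
    rw [det_incidence_cell hz hx, ofReal_mul_cpow (hermFactor_pos hx k)
      (mul_ne_zero (inv_ne_zero hT) (ne_zero_of_re_pos hh)),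
      mul_cpow_of_re_pos (inv_re_pos hTp) hh, inv_cpow_of_re_pos hTp]
    ring
  -- The total degree -2r is exactly what the Jacobian factor (det t')^(-2r) compensates.
  have hTs : ∏ k, T ^ α k = (T ^ (2 * r))⁻¹ := by
    have : ∏ k, T ^ α k = T ^ (-((2 * r : ℕ) : ℂ)) := by
      rw [show -((2 * r : ℕ) : ℂ) = ∑ k, α k by rw [hα]; push_cast; ring,
        Fin.sum_univ_three, Fin.prod_univ_three, Complex.cpow_add _ _ hT, Complex.cpow_add _ _ hT]
    rw [this, Complex.cpow_neg, Complex.cpow_natCast]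
  have hp : pullbackCoeff (cell z) x = (T ^ (2 * r))⁻¹ * ((gMatrix z).det ^ r)⁻¹ *
      (-2 * Complex.I) ^ (r * (r - 1) / 2) := pullbackCoeff_cell z x hT
  rw [radonIntegrand, character, hp]
  simp_rw [hk]
  rw [Finset.prod_mul_distrib, Finset.prod_mul_distrib, Finset.prod_inv_distrib, hTs,
    prod_hermFactor_cpow hx, ← minorPower_eq hz hα, inv_inv]
  have : T ^ (2 * r) ≠ 0 := pow_ne_zero _ hT
  field_simp

theorem radonBeta_eq {r : ℕ} {z : Vars r} (hz : NearNormalForm z) {α : Fin 3 → ℂ}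
    (hα : ∑ k, α k = -(2 * r : ℂ)) :
    radonBeta z α = minorPower α z * (-2 * Complex.I) ^ (r * (r - 1) / 2) *
      hermBeta r (α 1 + r) (α 2 + r) := by
  rw [radonBeta, radonIntegral, setIntegral_congr_fun (measurableSet_betaDomain r)
    (fun x hx => radonIntegrand_cell hz hα hx), integral_const_mul]
  rfl

theorem Admissible.re_lt {r : ℕ} {α : Fin 3 → ℂ} (hα : Admissible r α) :
    (r : ℝ) - 1 < (α 1 + r).re ∧ (r : ℝ) - 1 < (α 2 + r).re := by
  have h1 := hα.2.1
  have h2 := hα.2.2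
  simp only [Complex.add_re, Complex.natCast_re]
  constructor <;> linarith

theorem integrableOn_radonIntegrand {r : ℕ} {z : Vars r} (hz : NearNormalForm z) {α : Fin 3 → ℂ}
    (hα : Admissible r α) : IntegrableOn (radonIntegrand (cell z) z α) (betaDomain r) := by
  refine IntegrableOn.congr_fun ?_ (fun x hx => (radonIntegrand_cell hz hα.1 hx).symm)
    (measurableSet_betaDomain r)
  exact (hermBeta_eq_prod r hα.re_lt.1 hα.re_lt.2).1.const_mul _

theorem minorPower_normalForm (r : ℕ) (α : Fin 3 → ℂ) : minorPower α (normalForm r) = 1 := by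
  rw [minorPower, normMinor_normalForm r (by decide), normMinor_normalForm r (by decide),
    normMinor_normalForm r (by decide)]
  simp

theorem radonBeta_normalForm {r : ℕ} {α : Fin 3 → ℂ} (hα : ∑ k, α k = -(2 * r : ℂ)) :
    radonBeta (normalForm r) α = (-2 * Complex.I) ^ (r * (r - 1) / 2) *
      hermBeta r (α 1 + r) (α 2 + r) := by
  rw [radonBeta_eq (eventually_nearNormalForm r).self_of_nhds hα, minorPower_normalForm, one_mul]

/-! ### The contiguity operators as derivations -/

theorem analyticAt_coord {r : ℕ} (k : Fin 3) (c : Fin r ⊕ Fin r) (q : Fin r) (z : Vars r) :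
    AnalyticAt ℂ (fun w : Vars r => w k c q) z := by
  have h := ((ContinuousLinearMap.proj (R := ℂ) (φ := fun _ : Fin r => ℂ) q).comp
    ((ContinuousLinearMap.proj (R := ℂ) (φ := fun _ : Fin r ⊕ Fin r => Fin r → ℂ) c).comp
    (ContinuousLinearMap.proj (R := ℂ)
      (φ := fun _ : Fin 3 => (Fin r ⊕ Fin r) → Fin r → ℂ) k))).analyticAt z
  exact h

/-- The direction in which `contigEntry i j p q` differentiates: the column `q` of `z⁽ʲ⁾` moves
along the column `p` of `z⁽ⁱ⁾`. -/
def contigDir {r : ℕ} (i j : Fin 3) (p q : Fin r) (z : Vars r) : Vars r :=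
  Pi.single j fun c => Pi.single q (z i c p)

theorem contigDir_eq_sum {r : ℕ} (i j : Fin 3) (p q : Fin r) (z : Vars r) :
    contigDir i j p q z =
      ∑ c, z i c p • (Pi.single j (Pi.single c (Pi.single q 1)) : Vars r) := by
  funext k c q'
  simp only [contigDir, Finset.sum_apply, Pi.smul_apply, smul_eq_mul]
  by_cases hk : k = j
  · subst hk
    rw [Finset.sum_eq_single c]
    · by_cases hq : q' = q
      · subst hq; simp
      · simp [hq]
    · intro b _ hb; simp [Pi.single_eq_of_ne hb.symm]
    · simp
  · simp [hk]

/-- The entries of ᵗz⁽ⁱ⁾ ∂⁽ʲ⁾ are derivatives along a vector field, so they can be computed on the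
line z + t · `contigDir`. -/
theorem contigEntry_eq_fderiv {r : ℕ} {i j : Fin 3} {p q : Fin r} {f : Vars r → ℂ} {z : Vars r}
    (hf : DifferentiableAt ℂ f z) :
    contigEntry i j p q f z = fderiv ℂ f z (contigDir i j p q z) := by
  rw [contigDir_eq_sum, map_sum, contigEntry]
  refine Finset.sum_congr rfl fun c _ => ?_
  rw [map_smul, partialZ, hf.lineDeriv_eq_fderiv, smul_eq_mul]

theorem hasLineDerivAt_contigEntry {r : ℕ} {i j : Fin 3} {p q : Fin r} {f : Vars r → ℂ}
    {z : Vars r} (hf : DifferentiableAt ℂ f z) :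
    HasLineDerivAt ℂ f (contigEntry i j p q f z) z (contigDir i j p q z) := by
  rw [contigEntry_eq_fderiv hf]
  exact hf.hasFDerivAt.hasLineDerivAt _

/-- An identity on an open set may be differentiated again, which the iterated operators require. -/
theorem contigEntry_congr {r : ℕ} {i j : Fin 3} {p q : Fin r} {f g : Vars r → ℂ} {V : Set (Vars r)}
    (hV : IsOpen V) (h : Set.EqOn f g V) (hf : AnalyticOnNhd ℂ f V) :
    Set.EqOn (contigEntry i j p q f) (contigEntry i j p q g) V := by
  intro z hz
  have e : f =ᶠ[nhds z] g := Filter.eventuallyEq_of_mem (hV.mem_nhds hz) h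
  have hd := (hf z hz).differentiableAt
  rw [contigEntry_eq_fderiv hd, contigEntry_eq_fderiv (hd.congr_of_eventuallyEq e.symm),
    e.fderiv_eq]

theorem analyticOnNhd_contigEntry {r : ℕ} {i j : Fin 3} {p q : Fin r} {f : Vars r → ℂ}
    {V : Set (Vars r)} (hV : IsOpen V) (hf : AnalyticOnNhd ℂ f V) :
    AnalyticOnNhd ℂ (contigEntry i j p q f) V := by
  refine Finset.analyticOnNhd_fun_sum _ fun c _ => ?_
  refine AnalyticOnNhd.mul (fun z _ => analyticAt_coord i c p z) ?_
  refine AnalyticOnNhd.congr hV (f := fun z => fderiv ℂ f z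
    (Pi.single j (Pi.single c (Pi.single q 1)))) ?_ fun z hz => ?_
  · exact fun z hz => ((ContinuousLinearMap.apply ℂ ℂ
      (Pi.single j (Pi.single c (Pi.single q 1)) : Vars r)).analyticAt _).comp (hf.fderiv z hz)
  · exact ((hf z hz).differentiableAt.lineDeriv_eq_fderiv).symm

theorem contigEntry_sum {r : ℕ} {i j : Fin 3} {p q : Fin r} {ι : Type*} (s : Finset ι)
    (c : ι → ℂ) {f : ι → Vars r → ℂ} {z : Vars r} (hf : ∀ a ∈ s, DifferentiableAt ℂ (f a) z) :
    contigEntry i j p q (fun w => ∑ a ∈ s, c a * f a w) z =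
      ∑ a ∈ s, c a * contigEntry i j p q (f a) z := by
  have h : HasLineDerivAt ℂ (fun w => ∑ a ∈ s, c a * f a w)
      (∑ a ∈ s, c a * contigEntry i j p q (f a) z) z (contigDir i j p q z) :=
    HasDerivAt.fun_sum fun a ha => (hasLineDerivAt_contigEntry (hf a ha)).const_mul (c a)
  refine (hasLineDerivAt_contigEntry ?_).unique h
  exact DifferentiableAt.fun_sum fun a ha => (hf a ha).const_mul (c a)

/-! ### The Cayley identity -/

theorem sum_sign_mul_swap {n : Type*} [Fintype n] [DecidableEq n] {k q : n} (hkq : k ≠ q)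
    {w P : Equiv.Perm n → ℂ} (hw : ∀ σ, w (σ * Equiv.swap k q) = w σ) :
    ∑ σ : Equiv.Perm n, ((Equiv.Perm.sign σ : ℤ) : ℂ) * w σ * P (σ * Equiv.swap k q) =
      -∑ σ : Equiv.Perm n, ((Equiv.Perm.sign σ : ℤ) : ℂ) * w σ * P σ := by
  rw [← Finset.sum_neg_distrib, ← Equiv.sum_comp (Equiv.mulRight (Equiv.swap k q))]
  refine Finset.sum_congr rfl fun σ _ => ?_
  simp only [Equiv.coe_mulRight, hw, mul_assoc, Equiv.swap_mul_self, mul_one]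
  rw [Equiv.Perm.sign_mul, Equiv.Perm.sign_swap hkq]
  push_cast
  ring

/-- Differentiating the factor X_{q,σ(q)} in column k yields X_{q,σ(k)} X_{k,σ(q)}: the same
monomial with the values of σ at k and q exchanged. -/
theorem prod_insert_swap {n : Type*} [DecidableEq n] {X : n → n → ℂ} {k q : n} {S : Finset n}
    (hk : k ∉ S) (hq : q ∈ S) (σ : Equiv.Perm n) :
    ∏ a ∈ insert k S, X a ((σ * Equiv.swap k q) a) =
      X q (σ k) * X k (σ q) * ∏ a ∈ S.erase q, X a (σ a) := by
  have hkq : k ≠ q := fun h => hk (h ▸ hq)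
  rw [Finset.prod_insert hk, ← Finset.mul_prod_erase S _ hq]
  simp only [Equiv.Perm.mul_apply, Equiv.swap_apply_left, Equiv.swap_apply_right]
  rw [← mul_assoc, mul_comm (X q (σ k))]
  congr 1
  refine Finset.prod_congr rfl fun a ha => ?_
  rw [Finset.mem_erase] at ha
  rw [Equiv.swap_apply_of_ne_of_ne (fun h : a = k => hk (h ▸ ha.2)) ha.1]

/-- Functions `Φ` and `X` on which the derivations `contigEntry i j p q` act like `∂ / ∂ A_{pq}`
on `(det A)^s` and on the entries of `A⁻¹`. -/
structure CayleyPair {r : ℕ} (i j : Fin 3) (V : Set (Vars r)) (s : ℂ) (Φ : Vars r → ℂ)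
    (X : Vars r → Matrix (Fin r) (Fin r) ℂ) : Prop where
  isOpen : IsOpen V
  analytic_fun : AnalyticOnNhd ℂ Φ V
  analytic_inv : ∀ a b, AnalyticOnNhd ℂ (fun z => X z a b) V
  deriv_fun : ∀ z ∈ V, ∀ p q, HasLineDerivAt ℂ Φ (s * Φ z * X z q p) z (contigDir i j p q z)
  deriv_inv : ∀ z ∈ V, ∀ p q a b,
    HasLineDerivAt ℂ (fun z => X z a b) (-(X z a p * X z q b)) z (contigDir i j p q z)

namespace CayleyPair

variable {r : ℕ} {i j : Fin 3} {V : Set (Vars r)} {s : ℂ} {Φ : Vars r → ℂ}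
  {X : Vars r → Matrix (Fin r) (Fin r) ℂ}

/-- The product of the operators of the columns in `l`. -/
def iterate (i j : Fin 3) (Φ : Vars r → ℂ) (l : List (Fin r)) (σ : Equiv.Perm (Fin r)) :
    Vars r → ℂ :=
  l.foldr (fun q h => contigEntry i j (σ q) q h) Φ

theorem analyticOnNhd_iterate (h : CayleyPair i j V s Φ X) (l : List (Fin r))
    (σ : Equiv.Perm (Fin r)) : AnalyticOnNhd ℂ (iterate i j Φ l σ) V := by
  induction l with
  | nil => exact h.analytic_fun
  | cons k l ih => exact analyticOnNhd_contigEntry h.isOpen ih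

theorem analyticOnNhd_mul_prod (h : CayleyPair i j V s Φ X) (S : Finset (Fin r))
    (σ : Equiv.Perm (Fin r)) :
    AnalyticOnNhd ℂ (fun z => Φ z * ∏ a ∈ S, X z a (σ a)) V :=
  h.analytic_fun.mul (Finset.analyticOnNhd_fun_prod _ fun a _ => h.analytic_inv a _)

/-- The Leibniz rule: Φ contributes s times the enlarged monomial, and each factor q ∈ S contributes
minus its transposed version. -/
theorem contigEntry_mul_prod (h : CayleyPair i j V s Φ X) {S : Finset (Fin r)} {k : Fin r}
    (hk : k ∉ S) (σ : Equiv.Perm (Fin r)) {z : Vars r} (hz : z ∈ V) :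
    contigEntry i j (σ k) k (fun z => Φ z * ∏ a ∈ S, X z a (σ a)) z =
      Φ z * (s * ∏ a ∈ insert k S, X z a (σ a) -
        ∑ q ∈ S, ∏ a ∈ insert k S, X z a ((σ * Equiv.swap k q) a)) := by
  have hprod : HasLineDerivAt ℂ (fun z => ∏ a ∈ S, X z a (σ a))
      (∑ q ∈ S, (∏ a ∈ S.erase q, X z a (σ a)) * -(X z q (σ k) * X z k (σ q))) z
      (contigDir i j (σ k) k z) := by
    have := HasDerivAt.fun_finsetProd (u := S)
      (fun q _ => h.deriv_inv z hz (σ k) k q (σ q))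
    simpa [HasLineDerivAt] using this
  have hmul : HasLineDerivAt ℂ (fun z => Φ z * ∏ a ∈ S, X z a (σ a))
      (s * Φ z * X z k (σ k) * ∏ a ∈ S, X z a (σ a) + Φ z *
        ∑ q ∈ S, (∏ a ∈ S.erase q, X z a (σ a)) * -(X z q (σ k) * X z k (σ q))) z
      (contigDir i j (σ k) k z) := by
    have := HasDerivAt.fun_mul (h.deriv_fun z hz (σ k) k) hprod
    simpa [HasLineDerivAt] using this
  rw [(hasLineDerivAt_contigEntry
    ((h.analyticOnNhd_mul_prod S σ) z hz).differentiableAt).unique hmul,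
    Finset.sum_congr rfl fun q hq => prod_insert_swap (X := X z) hk hq σ, Finset.prod_insert hk, mul_sub,
    sub_eq_add_neg, ← mul_neg, ← Finset.sum_neg_distrib]
  congr 1
  · ring
  · congr 1
    refine Finset.sum_congr rfl fun q _ => ?_
    ring

/-- When column k is added to l, Φ contributes s. Each of the |l| transposed monomials contributes
+1, because the sign of the derivative of X cancels that of the transposition in the alternating
sum. The factor is s + |l|, and no two operators are ever commuted. The weight `w` is needed because
the outer operator depends on σ(k), so the hypothesis for l must hold with that value prescribed. -/
theorem sum_iterate (h : CayleyPair i j V s Φ X) (l : List (Fin r)) (hl : l.Nodup)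
    (w : Equiv.Perm (Fin r) → ℂ)
    (hw : ∀ σ, ∀ k ∈ l, ∀ q ∈ l, w (σ * Equiv.swap k q) = w σ) :
    Set.EqOn
      (fun z => ∑ σ : Equiv.Perm (Fin r), ((Equiv.Perm.sign σ : ℤ) : ℂ) * w σ * iterate i j Φ l σ z)
      (fun z => ∑ σ : Equiv.Perm (Fin r), bFun l.length s * (((Equiv.Perm.sign σ : ℤ) : ℂ) * w σ) *
        (Φ z * ∏ a ∈ l.toFinset, X z a (σ a))) V := by
  induction l generalizing w with
  | nil =>
    intro z _
    simp [iterate, bFun]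
  | cons k l ih =>
    rw [List.nodup_cons] at hl
    have hk : k ∉ l.toFinset := by simpa using hl.1
    intro z hz
    set S := l.toFinset
    have hcard : (S.card : ℂ) = l.length := by rw [List.toFinset_card_of_nodup hl.2]
    set sg := fun σ : Equiv.Perm (Fin r) => ((Equiv.Perm.sign σ : ℤ) : ℂ)
    -- `wp p` restricts the sum to σ(k) = p. Transpositions inside `l` do not move k, so it is an
    -- admissible weight for the tail.
    set wp := fun (p : Fin r) (σ : Equiv.Perm (Fin r)) => if σ k = p then w σ else 0
    have hwp : ∀ p σ, ∀ a ∈ l, ∀ b ∈ l, wp p (σ * Equiv.swap a b) = wp p σ := by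
      intro p σ a ha b hb
      have hak : k ≠ a := fun e => hl.1 (e ▸ ha)
      have hbk : k ≠ b := fun e => hl.1 (e ▸ hb)
      simp only [wp, Equiv.Perm.mul_apply, Equiv.swap_apply_of_ne_of_ne hak hbk]
      rw [hw σ a (List.mem_cons_of_mem _ ha) b (List.mem_cons_of_mem _ hb)]
    have split : ∀ f : Fin r → Equiv.Perm (Fin r) → ℂ,
        ∑ σ, sg σ * w σ * f (σ k) σ = ∑ p, ∑ σ, sg σ * wp p σ * f p σ := by
      intro f
      rw [Finset.sum_comm]
      refine Finset.sum_congr rfl fun σ _ => ?_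
      rw [Finset.sum_eq_single (σ k)]
      · simp [wp]
      · intro p _ hp; simp [wp, hp.symm]
      · simp
    have hdi : ∀ σ, DifferentiableAt ℂ (iterate i j Φ l σ) z :=
      fun σ => (h.analyticOnNhd_iterate l σ z hz).differentiableAt
    have hdp : ∀ σ : Equiv.Perm (Fin r), DifferentiableAt ℂ (fun z => Φ z * ∏ a ∈ S, X z a (σ a)) z :=
      fun σ => (h.analyticOnNhd_mul_prod S σ z hz).differentiableAt
    have han : ∀ p, AnalyticOnNhd ℂ
        (fun z => ∑ σ : Equiv.Perm (Fin r), sg σ * wp p σ * iterate i j Φ l σ z) V :=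
      fun p => Finset.analyticOnNhd_fun_sum _ fun σ _ =>
        analyticOnNhd_const.mul (h.analyticOnNhd_iterate l σ)
    -- For fixed p the operator does not depend on σ and can be applied to the whole identity for
    -- the tail.
    have step : ∀ p, ∑ σ, sg σ * wp p σ * contigEntry i j p k (iterate i j Φ l σ) z =
        ∑ σ, sg σ * wp p σ * (bFun l.length s *
          contigEntry i j p k (fun z => Φ z * ∏ a ∈ S, X z a (σ a)) z) := by
      intro p
      rw [← contigEntry_sum _ _ fun σ _ => hdi σ,
        contigEntry_congr h.isOpen (ih hl.2 (wp p) (hwp p)) (han p) hz,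
        contigEntry_sum _ _ fun σ _ => hdp σ]
      refine Finset.sum_congr rfl fun σ _ => ?_
      ring
    set P := fun σ : Equiv.Perm (Fin r) => ∏ a ∈ insert k S, X z a (σ a) with hP
    have hsw : ∀ q ∈ S, ∑ σ, sg σ * w σ * P (σ * Equiv.swap k q) = -∑ σ, sg σ * w σ * P σ := by
      intro q hq
      refine sum_sign_mul_swap (fun e : k = q => hk (e ▸ hq)) fun σ => ?_
      exact hw σ k List.mem_cons_self q (List.mem_cons_of_mem _ (by simpa [S] using hq))
    calc ∑ σ, sg σ * w σ * contigEntry i j (σ k) k (iterate i j Φ l σ) z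
        = ∑ σ, sg σ * w σ * (bFun l.length s *
          contigEntry i j (σ k) k (fun z => Φ z * ∏ a ∈ S, X z a (σ a)) z) := by
          rw [split fun p σ => contigEntry i j p k (iterate i j Φ l σ) z,
            Finset.sum_congr rfl fun p _ => step p,
            split fun p σ => bFun l.length s *
              contigEntry i j p k (fun z => Φ z * ∏ a ∈ S, X z a (σ a)) z]
      _ = bFun l.length s * Φ z * (s * (∑ σ, sg σ * w σ * P σ) -
          ∑ q ∈ S, ∑ σ, sg σ * w σ * P (σ * Equiv.swap k q)) := by
          rw [Finset.sum_comm, Finset.mul_sum, ← Finset.sum_sub_distrib, Finset.mul_sum]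
          refine Finset.sum_congr rfl fun σ _ => ?_
          rw [h.contigEntry_mul_prod hk σ hz, ← Finset.mul_sum]
          ring
      _ = bFun l.length s * Φ z * ((s + l.length) * ∑ σ, sg σ * w σ * P σ) := by
          rw [Finset.sum_congr rfl hsw, Finset.sum_const, nsmul_eq_mul, hcard]
          ring
      _ = _ := by
          simp only [List.length_cons, List.toFinset_cons]
          rw [bFun, bFun, Finset.prod_range_succ, Finset.mul_sum, Finset.mul_sum]
          refine Finset.sum_congr rfl fun σ _ => ?_
          simp only [hP, sg, S]
          ring

/-- The Cayley identity. -/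
theorem contigOp_eq (h : CayleyPair i j V s Φ X) {z : Vars r} (hz : z ∈ V) :
    contigOp i j Φ z = bFun r s * Φ z * (X z).det := by
  have := h.sum_iterate (List.finRange r) (List.nodup_finRange r) (fun _ => 1)
    (fun _ _ _ _ _ => rfl) hz
  simp only [mul_one, List.length_finRange, List.toFinset_finRange] at this
  rw [contigOp, ← Matrix.det_transpose, Matrix.det_apply', Finset.mul_sum]
  refine this.trans (Finset.sum_congr rfl fun σ _ => ?_)
  simp only [Matrix.transpose_apply]
  ring

end CayleyPair

/-! ### The contiguity relations -/

theorem analyticAt_det {r : ℕ} {n : Type*} [Fintype n] [DecidableEq n]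
    {M : Vars r → Matrix n n ℂ} {z : Vars r} (hM : ∀ a b, AnalyticAt ℂ (fun w => M w a b) z) :
    AnalyticAt ℂ (fun w => (M w).det) z := by
  simp only [Matrix.det_apply']
  exact Finset.analyticAt_fun_sum _ fun σ _ =>
    analyticAt_const.mul (Finset.analyticAt_fun_prod _ fun a _ => hM _ _)

theorem analyticAt_fromCols {r : ℕ} (i j : Fin 3) (z : Vars r) (a b : Fin r ⊕ Fin r) :
    AnalyticAt ℂ (fun w : Vars r => Matrix.fromCols (block w i) (block w j) a b) z := by
  rcases b with b | b
  · exact analyticAt_coord i a b z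
  · exact analyticAt_coord j a b z

theorem analyticAt_normMinor {r : ℕ} (i j : Fin 3) (z : Vars r) :
    AnalyticAt ℂ (normMinor i j) z :=
  (analyticAt_det (analyticAt_fromCols i j z)).div_const

theorem NearNormalForm.normMinor_mem_slitPlane {r : ℕ} {z : Vars r} (hz : NearNormalForm z)
    {i j : Fin 3} (hij : i ≠ j) : normMinor i j z ∈ Complex.slitPlane := by
  have h01 := Complex.mem_slitPlane_iff.2 (Or.inl hz.pos_zero_one)
  have h02 := Complex.mem_slitPlane_iff.2 (Or.inl hz.pos_zero_two)
  have h12 := Complex.mem_slitPlane_iff.2 (Or.inl hz.pos_one_two)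
  fin_cases i <;> fin_cases j
  · exact absurd rfl hij
  · exact h01
  · exact h02
  · rw [normMinor_comm]; exact h01
  · exact absurd rfl hij
  · exact h12
  · rw [normMinor_comm]; exact h02
  · rw [normMinor_comm]; exact h12
  · exact absurd rfl hij

theorem minorPower_eq_of_ne {r : ℕ} (α : Fin 3 → ℂ) (z : Vars r) {i j k : Fin 3} (hij : i ≠ j)
    (hik : i ≠ k) (hjk : j ≠ k) :
    minorPower α z = normMinor i j z ^ (-(r : ℂ) - α k) * normMinor i k z ^ (-(r : ℂ) - α j) *
      normMinor j k z ^ (-(r : ℂ) - α i) := by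
  have c10 := normMinor_comm (r := r) 1 0
  have c20 := normMinor_comm (r := r) 2 0
  have c21 := normMinor_comm (r := r) 2 1
  fin_cases i <;> fin_cases j <;> fin_cases k <;>
    simp only [Fin.zero_eta, Fin.mk_one, Fin.reduceFinMk, ne_eq, not_true_eq_false] at hij hik hjk ⊢ <;>
    simp only [minorPower, c10, c20, c21] <;> ring

/-- The shift lowers the exponent of the minor (j,k) by one, raises that of (i,k) by one, and leaves
(i,j) alone. -/
theorem minorPower_shift {r : ℕ} (α : Fin 3 → ℂ) {z : Vars r} (hz : NearNormalForm z)
    {i j k : Fin 3} (hij : i ≠ j) (hik : i ≠ k) (hjk : j ≠ k) :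
    minorPower (shift α i j) z = minorPower α z * (normMinor i k z / normMinor j k z) := by
  have n1 := Complex.slitPlane_ne_zero (hz.normMinor_mem_slitPlane hik)
  have n2 := Complex.slitPlane_ne_zero (hz.normMinor_mem_slitPlane hjk)
  have ei : -(r : ℂ) - shift α i j i = -(r : ℂ) - α i - 1 := by simp [shift, hij]; ring
  have ej : -(r : ℂ) - shift α i j j = -(r : ℂ) - α j + 1 := by simp [shift, hij.symm]; ring
  have ek : shift α i j k = α k := by simp [shift, hik.symm, hjk.symm]
  rw [minorPower_eq_of_ne _ z hij hik hjk, minorPower_eq_of_ne α z hij hik hjk, ei, ej, ek,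
    Complex.cpow_sub _ _ n2, Complex.cpow_add _ _ n1, Complex.cpow_one, Complex.cpow_one]
  ring

theorem analyticAt_minorPower {r : ℕ} (α : Fin 3 → ℂ) {z : Vars r} (hz : NearNormalForm z) :
    AnalyticAt ℂ (minorPower α) z := by
  have h : ∀ {i j : Fin 3} (s : ℂ), i ≠ j → AnalyticAt ℂ (fun z => normMinor i j z ^ s) z :=
    fun s hij => (analyticAt_normMinor _ _ z).cpow analyticAt_const
      (hz.normMinor_mem_slitPlane hij)
  exact ((h _ (by decide)).mul (h _ (by decide))).mul (h _ (by decide))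

/-! ### Derivatives of the minors along the contiguity directions -/

/-- The upper half of `(z⁽ʲ⁾, z⁽ᵏ⁾)⁻¹ z⁽ⁱ⁾`. -/
def upperSolution {r : ℕ} (i j k : Fin 3) (z : Vars r) : Matrix (Fin r) (Fin r) ℂ :=
  ((Matrix.fromCols (block z j) (block z k))⁻¹ * block z i).toRows₁

/-- Cramer's rule. It gives analyticity of the entries and the derivative of the minor. -/
theorem upperSolution_apply {r : ℕ} (i j k : Fin 3) {z : Vars r} (hz : minor z j k ≠ 0)
    (a b : Fin r) :
    minor z j k * upperSolution i j k z a b =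
      ((Matrix.fromCols (block z j) (block z k)).updateCol (Sum.inl a) fun c => z i c b).det := by
  rw [← Matrix.cramer_apply, ← Matrix.det_smul_inv_mulVec_eq_cramer _ _ hz.isUnit]
  rfl

theorem det_upperSolution {r : ℕ} (i j k : Fin 3) {z : Vars r} (hz : minor z j k ≠ 0) :
    (upperSolution i j k z).det = minor z i k / minor z j k := by
  set N := Matrix.fromCols (block z j) (block z k) with hN
  set Y := N⁻¹ * block z i with hY
  have e : N * Matrix.fromBlocks Y.toRows₁ 0 Y.toRows₂ 1 =
      Matrix.fromCols (block z i) (block z k) := by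
    rw [hN, Matrix.fromCols_mul_fromBlocks, ← Matrix.fromCols_mul_fromRows,
      Matrix.fromRows_toRows, ← hN, hY, Matrix.mul_nonsing_inv_cancel_left _ _ hz.isUnit]
    simp
  have := congrArg Matrix.det e
  rw [Matrix.det_mul, Matrix.det_fromBlocks_zero₁₂, Matrix.det_one, mul_one] at this
  rw [eq_div_iff hz, mul_comm]
  exact this

theorem analyticAt_upperSolution {r : ℕ} (i j k : Fin 3) {z : Vars r} (hz : minor z j k ≠ 0)
    (a b : Fin r) : AnalyticAt ℂ (fun w => upperSolution i j k w a b) z := by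
  have h1 : AnalyticAt ℂ (fun w : Vars r => ((Matrix.fromCols (block w j) (block w k)).updateCol
      (Sum.inl a) fun c => w i c b).det / minor w j k) z := by
    refine (analyticAt_det fun c d => ?_).div (analyticAt_det (analyticAt_fromCols j k z)) hz
    by_cases h : d = Sum.inl a
    · subst h; simpa using analyticAt_coord i c b z
    · simpa [h] using analyticAt_fromCols j k z c d
  refine h1.congr ?_
  filter_upwards [(continuous_minor r j k).continuousAt.eventually_ne hz] with w hw
  rw [← upperSolution_apply i j k hw, mul_div_cancel_left₀ _ hw]

/-- The derivative of `(z⁽ʲ⁾, z⁽ᵏ⁾)` in the direction `contigDir i j p q`. -/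
def columnMatrix {r : ℕ} (i : Fin 3) (p q : Fin r) (z : Vars r) :
    Matrix (Fin r ⊕ Fin r) (Fin r ⊕ Fin r) ℂ :=
  Matrix.of fun c d => if d = Sum.inl q then z i c p else 0

theorem block_add_smul_contigDir_of_ne {r : ℕ} {i j l : Fin 3} (hl : l ≠ j) (p q : Fin r)
    (z : Vars r) (t : ℂ) : block (z + t • contigDir i j p q z) l = block z l := by
  ext c d
  simp [block, contigDir, hl]

theorem fromCols_add_smul_contigDir {r : ℕ} {i j k : Fin 3} (hk : k ≠ j) (p q : Fin r)
    (z : Vars r) (t : ℂ) :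
    Matrix.fromCols (block (z + t • contigDir i j p q z) j)
        (block (z + t • contigDir i j p q z) k) =
      Matrix.fromCols (block z j) (block z k) + t • columnMatrix i p q z := by
  rw [block_add_smul_contigDir_of_ne hk]
  ext c d
  rcases d with d | d
  · by_cases h : d = q
    · subst h; simp [block, contigDir, columnMatrix]
    · simp [block, contigDir, columnMatrix, h]
  · simp [columnMatrix]

/-- Only one column moves, so the minor is affine in t, with slope given by Cramer's rule. -/
theorem hasLineDerivAt_minor {r : ℕ} {i j k : Fin 3} (hk : k ≠ j) {z : Vars r}
    (hz : minor z j k ≠ 0) (p q : Fin r) :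
    HasLineDerivAt ℂ (fun w => minor w j k) (minor z j k * upperSolution i j k z q p) z
      (contigDir i j p q z) := by
  set N := Matrix.fromCols (block z j) (block z k) with hN
  have e : ∀ t : ℂ, minor (z + t • contigDir i j p q z) j k =
      minor z j k + t * (minor z j k * upperSolution i j k z q p) := by
    intro t
    have hu : N + t • columnMatrix i p q z =
        N.updateCol (Sum.inl q) ((fun c => N c (Sum.inl q)) + t • fun c => z i c p) := by
      ext c d
      by_cases h : d = Sum.inl q
      · subst h; simp [columnMatrix]
      · simp [columnMatrix, h]
    rw [minor, fromCols_add_smul_contigDir hk, ← hN, hu, Matrix.det_updateCol_add,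
      Matrix.det_updateCol_smul, ← upperSolution_apply i j k hz, Matrix.updateCol_eq_self]
    rfl
  unfold HasLineDerivAt
  simp_rw [e]
  simpa using ((hasDerivAt_id (0 : ℂ)).mul_const
    (minor z j k * upperSolution i j k z q p)).const_add (minor z j k)

/-- z⁽ⁱ⁾ is constant along the direction, and N = (z⁽ʲ⁾, z⁽ᵏ⁾) moves by the one-column matrix E. The
derivative -N⁻¹ E N⁻¹ z⁽ⁱ⁾ factors into two entries. -/
theorem hasLineDerivAt_upperSolution {r : ℕ} {i j k : Fin 3} (hi : i ≠ j) (hk : k ≠ j)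
    {z : Vars r} (hz : minor z j k ≠ 0) (p q a b : Fin r) :
    HasLineDerivAt ℂ (fun w => upperSolution i j k w a b)
      (-(upperSolution i j k z a p * upperSolution i j k z q b)) z (contigDir i j p q z) := by
  set N := Matrix.fromCols (block z j) (block z k) with hN
  have h := hasDerivAt_inv_mul_pencil (𝕜 := ℂ) (T := N) (E := columnMatrix i p q z)
    (S := block z i) (G := 0) hz (Sum.inl a) b
  have e : (N⁻¹ * (0 - columnMatrix i p q z * (N⁻¹ * block z i)) :
      Matrix (Fin r ⊕ Fin r) (Fin r) ℂ) (Sum.inl a) b =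
      -(upperSolution i j k z a p * upperSolution i j k z q b) := by
    have hc : ∀ c, (columnMatrix i p q z * (N⁻¹ * block z i)) c b =
        z i c p * upperSolution i j k z q b := by
      intro c
      rw [Matrix.mul_apply, Finset.sum_eq_single (Sum.inl q)]
      · simp [columnMatrix, upperSolution, hN]
      · intro d _ hd; simp [columnMatrix, hd]
      · simp
    rw [zero_sub, Matrix.mul_neg, Matrix.neg_apply, Matrix.mul_apply]
    simp only [hc, ← mul_assoc]
    rw [← Finset.sum_mul]
    rfl
  rw [e] at h
  have hf : (fun t : ℂ => upperSolution i j k (z + t • contigDir i j p q z) a b) =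
      fun t : ℂ => ((N + t • columnMatrix i p q z)⁻¹ * (block z i + t • 0) :
        Matrix (Fin r ⊕ Fin r) (Fin r) ℂ) (Sum.inl a) b := by
    funext t
    rw [upperSolution, fromCols_add_smul_contigDir hk, block_add_smul_contigDir_of_ne hi,
      smul_zero, add_zero]
    rfl
  unfold HasLineDerivAt
  rw [hf]
  exact h

/-- Adding a multiple of a column of z⁽ⁱ⁾ to a column of z⁽ʲ⁾ is a unipotent column operation on
(z⁽ⁱ⁾, z⁽ʲ⁾). -/
theorem normMinor_add_smul_contigDir {r : ℕ} {i j : Fin 3} (hij : i ≠ j) (p q : Fin r)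
    (z : Vars r) (t : ℂ) :
    normMinor i j (z + t • contigDir i j p q z) = normMinor i j z := by
  have e : Matrix.fromCols (block (z + t • contigDir i j p q z) i)
      (block (z + t • contigDir i j p q z) j) = Matrix.fromCols (block z i) (block z j) *
        Matrix.fromBlocks 1 (Matrix.of fun a b => if a = p ∧ b = q then t else 0) 0 1 := by
    rw [Matrix.fromCols_mul_fromBlocks, block_add_smul_contigDir_of_ne hij]
    ext c d
    rcases d with d | d
    · simp
    · by_cases h : d = q
      · subst h
        simp [block, contigDir, Matrix.mul_apply]
        ring
      · simp [block, contigDir, Matrix.mul_apply, h]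
  have := congrArg Matrix.det e
  rw [Matrix.det_mul, Matrix.det_fromBlocks_zero₂₁, Matrix.det_one, mul_one,
    mul_one] at this
  rw [normMinor, normMinor, minor, this]
  rfl

theorem hasLineDerivAt_minorPower {r : ℕ} (α : Fin 3 → ℂ) {z : Vars r} (hz : NearNormalForm z)
    {i j k : Fin 3} (hij : i ≠ j) (hik : i ≠ k) (hjk : j ≠ k) (p q : Fin r) :
    HasLineDerivAt ℂ (minorPower α)
      ((-(r : ℂ) - α i) * minorPower α z * upperSolution i j k z q p) z
      (contigDir i j p q z) := by
  have h0 := hz.normMinor_mem_slitPlane hjk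
  have hne := Complex.slitPlane_ne_zero h0
  have hm := hasLineDerivAt_minor (i := i) hjk.symm (hz.minor_ne_zero hjk) p q
  unfold HasLineDerivAt at hm ⊢
  have h1 : HasDerivAt (fun t : ℂ => normMinor j k (z + t • contigDir i j p q z))
      (normMinor j k z * upperSolution i j k z q p) 0 := by
    have := hm.div_const (minor (normalForm r) j k)
    rwa [mul_div_right_comm] at this
  have hik' : ∀ t : ℂ, normMinor i k (z + t • contigDir i j p q z) = normMinor i k z := by
    intro t
    rw [normMinor, minor, block_add_smul_contigDir_of_ne hij,
      block_add_smul_contigDir_of_ne hjk.symm]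
    rfl
  have h2 := (h1.cpow_const (c := -(r : ℂ) - α i) (by simpa using h0)).const_mul
    (normMinor i j z ^ (-(r : ℂ) - α k) * normMinor i k z ^ (-(r : ℂ) - α j))
  simp only [minorPower_eq_of_ne α _ hij hik hjk, normMinor_add_smul_contigDir hij, hik']
  refine h2.congr_deriv ?_
  simp only [zero_smul, add_zero]
  rw [Complex.cpow_sub _ _ hne, Complex.cpow_one]
  field_simp

/-! ### The contiguity operators applied to F -/

theorem cayleyPair_radonBeta {r : ℕ} {V : Set (Vars r)} (hV : IsOpen V)
    (hn : ∀ z ∈ V, NearNormalForm z) {α : Fin 3 → ℂ} (hα : ∑ k, α k = -(2 * r : ℂ))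
    {i j k : Fin 3} (hij : i ≠ j) (hik : i ≠ k) (hjk : j ≠ k) :
    CayleyPair i j V (-(r : ℂ) - α i) (fun z => radonBeta z α) (upperSolution i j k) := by
  set K := (-2 * Complex.I) ^ (r * (r - 1) / 2) * hermBeta r (α 1 + r) (α 2 + r)
  have e : ∀ z ∈ V, radonBeta z α = K * minorPower α z := by
    intro z hz
    rw [radonBeta_eq (hn z hz) hα]
    ring
  have ev : ∀ z ∈ V, (fun w => radonBeta w α) =ᶠ[nhds z] fun w => K * minorPower α w :=
    fun z hz => Filter.eventuallyEq_of_mem (hV.mem_nhds hz) e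
  refine ⟨hV, fun z hz => ?_, fun a b z hz => ?_, fun z hz p q => ?_, fun z hz p q a b => ?_⟩
  · exact (analyticAt_const.mul (analyticAt_minorPower α (hn z hz))).congr (ev z hz).symm
  · exact analyticAt_upperSolution i j k ((hn z hz).minor_ne_zero hjk) a b
  · refine HasLineDerivAt.congr_of_eventuallyEq ?_ (ev z hz)
    have := HasDerivAt.const_mul K (hasLineDerivAt_minorPower α (hn z hz) hij hik hjk p q)
    simp only [e z hz]
    refine HasDerivAt.congr_deriv this ?_
    ring
  · exact hasLineDerivAt_upperSolution hij hjk.symm ((hn z hz).minor_ne_zero hjk) p q a b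

/-- The action of the contiguity operators, before the constants are compared. -/
theorem contigOp_radonBeta {r : ℕ} {V : Set (Vars r)} (hV : IsOpen V)
    (hn : ∀ z ∈ V, NearNormalForm z) {α : Fin 3 → ℂ} (hα : ∑ k, α k = -(2 * r : ℂ))
    {i j k : Fin 3} (hij : i ≠ j) (hik : i ≠ k) (hjk : j ≠ k) {z : Vars r} (hz : z ∈ V) :
    contigOp i j (fun w => radonBeta w α) z =
      rootSign r i j * bFun r (α i + 1) * radonBeta z α *
        (normMinor i k z / normMinor j k z) := by
  obtain ⟨m1, m2⟩ := minor_normalForm_ratio r hij hik hjk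
  have m3 := (hn z hz).minor_ne_zero hjk
  have m4 := minor_normalForm_ne_zero r hik
  -- The reflection s ↦ 1 - r - s multiplies b(s) by (-1)^r.
  have hb : bFun r (-(r : ℂ) - α i) = (-1) ^ r * bFun r (α i + 1) := by
    rw [bFun_add_one, ← bFun_neg]; ring_nf
  have hs := neg_one_pow_mul_self r
  rw [(cayleyPair_radonBeta hV hn hα hij hik hjk).contigOp_eq hz, det_upperSolution i j k m3, hb]
  have : minor z i k / minor z j k =
      (-1) ^ r * rootSign r i j * (normMinor i k z / normMinor j k z) := by
    have hY : minor (normalForm r) i k / minor (normalForm r) j k = (-1) ^ r * rootSign r i j := by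
      rw [m1, mul_div_cancel_right₀ _ m2]
    rw [normMinor, normMinor, div_div_div_comm, ← hY, mul_div_cancel₀ _ (div_ne_zero m4 m2)]
  rw [this]
  linear_combination (bFun r (α i + 1) * radonBeta z α * rootSign r i j *
    (normMinor i k z / normMinor j k z)) * hs

theorem exists_third (i j : Fin 3) : ∃ k, i ≠ k ∧ j ≠ k := by
  decide +revert

end RadonBeta

end

open RadonBeta
theorem proposition4p3 (r : ℕ) (hr : 0 < r) :
    -- near the normal form, `F(z,α;C)` is well defined and satisfies the contiguity relations
    (∃ V : Set (Vars r), IsOpen V ∧ normalForm r ∈ V ∧ V ⊆ genericVars r ∧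
      -- the cell lies in the affine chart and in the domain of the principal branch
      (∀ z ∈ V, ∀ x ∈ betaDomain r, ((cellHom z x).toCols₁).det ≠ 0 ∧
        ∀ k : Fin 3, (incidence (cell z x) z k).det ∈ Complex.slitPlane) ∧
      ∀ α : Fin 3 → ℂ, Admissible r α →
        (∀ z ∈ V, MeasureTheory.IntegrableOn (radonIntegrand (cell z) z α) (betaDomain r)) ∧
        AnalyticOnNhd ℂ (fun z : Vars r => radonBeta z α) V ∧
        ∀ i j : Fin 3, i ≠ j → Admissible r (shift α i j) →
          ∀ z ∈ V, contigOp i j (fun w => radonBeta w α) z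
            = bFun r (α j) * radonBeta z (shift α i j)) ∧
    -- the left side of the contiguity relation at the normal form, for each of the six roots
    (∀ α : Fin 3 → ℂ, Admissible r α → ∀ i j : Fin 3, i ≠ j →
      contigOp i j (fun w => radonBeta w α) (normalForm r)
        = (if i = 0 ∨ j = 0 then (-1) ^ r else 1) * bFun r (α i + 1) *
            radonBeta (normalForm r) α) ∧
    -- the beta function and its contiguity relations
    ∀ a b : ℂ, (r : ℝ) - 1 < a.re → (r : ℝ) - 1 < b.re →
      MeasureTheory.IntegrableOn (betaIntegrand r a b) (betaDomain r) ∧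
      radonBeta (normalForm r) (betaParam r a b)
        = (-2 * Complex.I) ^ (r * (r - 1) / 2) * hermBeta r a b ∧
      fallFun r (a + b) ≠ 0 ∧
      hermBeta r (a + 1) b = fallFun r a / fallFun r (a + b) * hermBeta r a b ∧
      hermBeta r a (b + 1) = fallFun r b / fallFun r (a + b) * hermBeta r a b := by
  obtain ⟨V, hVn, hV, hx⟩ := eventually_nhds_iff.1 (eventually_nearNormalForm r)
  refine ⟨⟨V, hV, hx, fun z hz => (hVn z hz).mem_genericVars, fun z hz x hxb =>
    ⟨ne_zero_of_re_pos ((hVn z hz).pos_chart x hxb),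
      fun k => det_incidence_mem_slitPlane (hVn z hz) hxb k⟩, fun α hα =>
    ⟨fun z hz => integrableOn_radonIntegrand (hVn z hz) hα,
      (cayleyPair_radonBeta hV hVn hα.1 (i := 0) (j := 1) (k := 2) (by decide) (by decide)
        (by decide)).analytic_fun, fun i j hij hs z hz => ?_⟩⟩, fun α hα i j hij => ?_,
    fun a b ha hb => ?_⟩
  · obtain ⟨k, hik, hjk⟩ := exists_third i j
    -- Both sides carry the same power of minors and the same quotient of minors. What remains is
    -- the scalar identity for B_r.
    rw [contigOp_radonBeta hV hVn hα.1 hij hik hjk hz, radonBeta_eq (hVn z hz) hα.1,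
      radonBeta_eq (hVn z hz) hs.1, minorPower_shift α (hVn z hz) hij hik hjk]
    linear_combination minorPower α z * (-2 * Complex.I) ^ (r * (r - 1) / 2) *
      (normMinor i k z / normMinor j k z) * hermBeta_contiguity hr hα hij hs
  · obtain ⟨k, hik, hjk⟩ := exists_third i j
    rw [contigOp_radonBeta hV hVn hα.1 hij hik hjk hx, normMinor_normalForm r hik,
      normMinor_normalForm r hjk, div_one, mul_one]
    rfl
  · have hr1 : (1 : ℝ) ≤ r := by exact_mod_cast hr
    -- Re(a+b) > 2r-2 ≥ r-1, where r ≥ 1 is needed.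
    have hab : fallFun r (a + b) ≠ 0 :=
      fallFun_ne_zero (by rw [Complex.add_re]; linarith)
    refine ⟨(hermBeta_eq_prod r ha hb).1, ?_, hab, ?_, ?_⟩
    · rw [radonBeta_normalForm]
      · simp [betaParam]
      · simp [betaParam, Fin.sum_univ_three]; ring
    · rw [div_mul_eq_mul_div, eq_div_iff hab, mul_comm,
        fallFun_mul_hermBeta_add_one_left r ha hb]
    · rw [div_mul_eq_mul_div, eq_div_iff hab, mul_comm,
        fallFun_mul_hermBeta_add_one_right r ha hb]
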